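/- All graphs are finite and simple, and paths need not be induced. A vertex $v$ of a path $P$ is a center of $P$ under a coloring $\psi$ if no other vertex of $P$ has the color $\psi(v)$. A coloring $\psi\colon V(G)\to\{1,\dots,n\}$ is linear if every path of $G$ has a center, and $\chi_{\mathrm{lin}}(G)$ is the minimum number of colors of a linear coloring of $G$. A $k$-pseudogrid in $G$ is a pair $(\mathcal P,\mathcal Q)$ of sequences $\mathcal P=(P_1,\dots,P_k)$ and $\mathcal Q=(Q_1,\dots,Q_k)$ of paths of $G$, the paths in each sequence being pairwise vertex-disjoint, such that (i) every $P_i$ is a concatenation of paths $P_{i,0},P^Q_{i,1},P_{i,1},P^Q_{i,2},P_{i,2},\dots,P^Q_{i,k},P_{i,k}$ in this order, where each $P^Q_{i,j}$ is a subpath of $Q_j$ (possibly a single vertex) and no $P_{i,j}$ with $0\le j\le k$ contains an edge or an internal vertex lying on any path of $\mathcal Q$ (here $P_{i,0}$ and $P_{i,k}$ may have length $0$); (ii) the same holds with the roles of $\mathcal P$ and $\mathcal Q$ exchanged. Lemma. If $G$ contains a $k$-pseudogrid, then $\chi_{\mathrm{lin}}(G)=\Omega(\sqrt k)$; that is, there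 is an absolute constant $c>0$ such that $\chi_{\mathrm{lin}}(G)\ge c\sqrt k$ for every $k$ and every graph $G$ that contains a $k$-pseudogrid. More precisely, for every linear coloring $\psi$ of a graph $G$ and every $k$-pseudogrid $(\mathcal P,\mathcal Q)$ in $G$, $$k\le 100\,\bigl(\mu(\mathcal P)+\mu(\mathcal Q)\bigr)^2,$$ where $\mu(\mathcal P)$ and $\mu(\mathcal Q)$ denote the numbers of distinct colors that $\psi$ uses on the vertices of the paths of $\mathcal P$ and of $\mathcal Q$, respectively. -/

import Mathlib

namespace LinearColoring

/-- A path of the graph `G` (a walk without repeated vertices, with at least one vertex, not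
necessarily induced), bundled with its two end vertices. -/
structure GPath {V : Type*} (G : SimpleGraph V) where
  src : V
  tgt : V
  walk : G.Walk src tgt
  isPath : walk.IsPath

namespace GPath

variable {V : Type*} {G : SimpleGraph V}

/-- The vertex set of a path. -/
def verts (p : GPath G) : Set V := {v | v ∈ p.walk.support}

/-- The edge set of a path. -/
def edges (p : GPath G) : Set (Sym2 V) := {e | e ∈ p.walk.edges}

/-- The number of edges of a path; its vertices are `p.vert 0, …, p.vert p.length` in order. -/
def length (p : GPath G) : ℕ := p.walk.length

/-- The vertex at position `t` of a path. -/
def vert (p : GPath G) (t : ℕ) : V := p.walk.getVert t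

end GPath

/-- `w` is a center of the path `p`: it lies on `p`, and no other vertex of `p` has its color. -/
def IsCenter {V α : Type*} {G : SimpleGraph V} (ψ : V → α) (p : GPath G) (w : V) : Prop :=
  w ∈ p.verts ∧ ∀ x ∈ p.verts, ψ x = ψ w → x = w

/-- A linear coloring: every path has a center. -/
def IsLinearColoring {V α : Type*} (G : SimpleGraph V) (ψ : V → α) : Prop :=
  ∀ p : GPath G, ∃ w, IsCenter ψ p w

/-- The linear coloring number: the least number of colors in a linear coloring.
(For a finite graph the set below is nonempty, since injective colorings are linear.) -/
noncomputable def linearColoringNumber {V : Type*} (G : SimpleGraph V) : ℕ :=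
  sInf {n : ℕ | ∃ ψ : V → Fin n, IsLinearColoring G ψ}

/-- The path `p` is a concatenation of paths `S₀, T₁, S₁, T₂, S₂, …, T_k, S_k`, in this order,
such that each `T_j` is a (possibly one-vertex) subpath of the `j`-th path of the family `Q`, and
no `S_j` has an edge or an internal vertex on a path of `Q`.

The concatenation is given by its cut positions on `p`: `S_j` is the part of `p` between
the positions `cut (2 * j)` and `cut (2 * j + 1)`, and `T_{j + 1}`, which belongs to `Q j` because
`Fin k` starts at `0`, is the part between `cut (2 * j + 1)` and `cut (2 * j + 2)`. -/
def CrossesInOrder {V : Type*} {G : SimpleGraph V} {k : ℕ} (p : GPath G)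
    (Q : Fin k → GPath G) : Prop :=
  ∃ cut : ℕ → ℕ,
    cut 0 = 0 ∧ cut (2 * k + 1) = p.length ∧
    (∀ t ≤ 2 * k, cut t ≤ cut (t + 1)) ∧
    (∀ j : Fin k,
      (∀ t, cut (2 * j + 1) ≤ t → t ≤ cut (2 * j + 2) → p.vert t ∈ (Q j).verts) ∧
      (∀ t, cut (2 * j + 1) ≤ t → t < cut (2 * j + 2) →
        s(p.vert t, p.vert (t + 1)) ∈ (Q j).edges)) ∧
    (∀ j ≤ k, ∀ l : Fin k,
      (∀ t, cut (2 * j) < t → t < cut (2 * j + 1) → p.vert t ∉ (Q l).verts) ∧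
      (∀ t, cut (2 * j) ≤ t → t < cut (2 * j + 1) →
        s(p.vert t, p.vert (t + 1)) ∉ (Q l).edges))

/-- The pair `(P, Q)` of sequences of `k` paths is a `k`-pseudogrid in `G`. -/
structure IsPseudogrid {V : Type*} {G : SimpleGraph V} {k : ℕ} (P Q : Fin k → GPath G) :
    Prop where
  disjoint_left : Pairwise fun i j => Disjoint (P i).verts (P j).verts
  disjoint_right : Pairwise fun i j => Disjoint (Q i).verts (Q j).verts
  crosses_left : ∀ i, CrossesInOrder (P i) Q
  crosses_right : ∀ j, CrossesInOrder (Q j) P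

/-- `G` contains a `k`-pseudogrid. -/
def ContainsPseudogrid {V : Type*} (G : SimpleGraph V) (k : ℕ) : Prop :=
  ∃ P Q : Fin k → GPath G, IsPseudogrid P Q

/-- The number of distinct colors that `ψ` uses on the vertices of a family of paths. -/
noncomputable def numColors {V α : Type*} {G : SimpleGraph V} {k : ℕ} (ψ : V → α)
    (P : Fin k → GPath G) : ℕ :=
  (ψ '' ⋃ i, (P i).verts).ncard

end LinearColoring

/-! The proof finds a path on which every color occurs at least twice, unless `k` is at most
quadratic in the number of colors. A path without a center contradicts linearity.

A pseudogrid is first thinned to an honest grid (`IsGrid`). Keeping a third of the rows and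
discarding the at most two columns per row that contain an end of a kept row still leaves a third of
the columns (`IsPseudogrid.exists_columns`). Then the common subpaths ("cells") of rows and columns
appear in the same order along all rows and along all columns, and there are no other meetings
between extreme crossings (`IsPseudogrid.exists_isGrid`).

Rare colors are then removed (`exists_robust`): deleting the few rows or columns that carry a rare
color eliminates the color. Each of the `O(μ)` colors costs `O(μ)` rows or columns, where `μ` is the
total number of colors on rows and columns. So if the grid is larger than a constant times `μ ^ 2`,
a nonempty grid survives in which every remaining color is found on linearly many rows, respectively
columns.

Frequency leaves enough freedom to select, for every color of the rows, occurrences on two rows far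
apart, and for every color found only on columns, occurrences on two columns avoiding the former
(`exists_spread`). In the square grid, a snake going down and up the selected columns, with sideways
detours that cover the selected row positions, passes through all of them (`pathIn_snake`,
`exists_grid_path`). Replacing grid vertices by cells and grid edges by segments turns the snake
into a path of `G` (`exists_lift`, `IsGrid.exists_path`). All its colors are repeated, so it has no
center (`IsGrid.not_isLinearColoring_of_range`). -/

namespace LinearColoring

open SimpleGraph

/-! ### Building paths -/

/-- Two paths meeting only in their common end concatenate to a path. -/
theorem isPath_append {V : Type*} {G : SimpleGraph V} {a b c : V} {w₁ : G.Walk a b}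
    {w₂ : G.Walk b c} (h₁ : w₁.IsPath) (h₂ : w₂.IsPath)
    (h : ∀ v ∈ w₁.support, v ∈ w₂.support → v = b) : (w₁.append w₂).IsPath := by
  rw [Walk.isPath_def, Walk.support_append, List.nodup_append]
  refine ⟨h₁.support_nodup, h₂.support_nodup.tail, ?_⟩
  rintro v hv _ hv' rfl
  obtain rfl := h v hv (List.mem_of_mem_tail hv')
  have := h₂.support_nodup
  rw [← Walk.cons_tail_support, List.nodup_cons] at this
  exact this.1 hv'

/-- An injective sequence of consecutively adjacent vertices is a path. -/
theorem exists_path_of_seq {V : Type*} {G : SimpleGraph V} (f : ℕ → V) {s t : ℕ} (hst : s ≤ t)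
    (hadj : ∀ u, s ≤ u → u < t → G.Adj (f u) (f (u + 1)))
    (hinj : ∀ u u', s ≤ u → u < u' → u' ≤ t → f u ≠ f u') :
    ∃ w : G.Walk (f s) (f t), w.IsPath ∧ (∀ v, v ∈ w.support ↔ ∃ u, s ≤ u ∧ u ≤ t ∧ f u = v) ∧
      ∀ u, s ≤ u → u < t → s(f u, f (u + 1)) ∈ w.edges := by
  induction t, hst using Nat.le_induction with
  | base =>
    refine ⟨Walk.nil, Walk.IsPath.nil, fun v => ?_, fun u h h' => by omega⟩
    rw [Walk.support_nil, List.mem_singleton]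
    constructor
    · rintro rfl
      exact ⟨s, le_rfl, le_rfl, rfl⟩
    · rintro ⟨u, h, h', rfl⟩
      rw [le_antisymm h' h]
  | succ t hst ih =>
    obtain ⟨w, hw, hs, he⟩ := ih (fun u h h' => hadj u h (by omega))
      (fun u u' h h' h'' => hinj u u' h h' (by omega))
    refine ⟨w.concat (hadj t hst (by omega)), ?_, fun v => ?_, fun u h h' => ?_⟩
    · refine hw.concat ?_ _
      rw [hs]
      rintro ⟨u, h, h', e⟩
      exact hinj u (t + 1) h (by omega) le_rfl e
    · rw [Walk.support_concat, List.mem_append, hs, List.mem_singleton]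
      constructor
      · rintro (⟨u, h, h', e⟩ | rfl)
        · exact ⟨u, h, by omega, e⟩
        · exact ⟨t + 1, by omega, le_rfl, rfl⟩
      · rintro ⟨u, h, h', e⟩
        rcases Nat.lt_or_ge t u with h1 | h1
        · right
          rw [← e, show u = t + 1 by omega]
        · exact .inl ⟨u, h, h1, e⟩
    · rw [Walk.edges_concat, List.concat_eq_append, List.mem_append, List.mem_singleton]
      rcases Nat.lt_or_ge u t with h1 | h1
      · exact .inl (he u h h1)
      · right
        rw [show u = t by omega]

/-! ### Snakes with detours in the square grid -/

/-- The infinite square grid; the vertex `(i, j)` lies in row `i` and column `j`. -/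
def gridGraph : SimpleGraph (ℕ × ℕ) where
  Adj x y := (x.1 = y.1 ∧ (x.2 + 1 = y.2 ∨ y.2 + 1 = x.2)) ∨
    (x.2 = y.2 ∧ (x.1 + 1 = y.1 ∨ y.1 + 1 = x.1))
  symm := ⟨fun x y h => by omega⟩
  loopless := ⟨fun x h => by omega⟩

theorem gridGraph_adj {x y : ℕ × ℕ} : gridGraph.Adj x y ↔
    (x.1 = y.1 ∧ (x.2 + 1 = y.2 ∨ y.2 + 1 = x.2)) ∨
      (x.2 = y.2 ∧ (x.1 + 1 = y.1 ∨ y.1 + 1 = x.1)) := Iff.rfl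

/-- There is a path from `a` to `b` inside the vertex set `U` that uses all edges of `E`. -/
def PathIn {V : Type*} (G : SimpleGraph V) (a b : V) (U : Set V) (E : Set (Sym2 V)) : Prop :=
  ∃ w : G.Walk a b, w.IsPath ∧ (∀ v ∈ w.support, v ∈ U) ∧ ∀ e ∈ E, e ∈ w.edges

namespace PathIn

variable {V : Type*} {G : SimpleGraph V} {a b c : V} {U U' : Set V} {E E' : Set (Sym2 V)}

theorem symm (h : PathIn G a b U E) : PathIn G b a U E := by
  obtain ⟨w, hw, hU, hE⟩ := h
  exact ⟨w.reverse, hw.reverse, by simpa using hU, by simpa using hE⟩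

theorem mono (h : PathIn G a b U E) (hU : U ⊆ U') (hE : E' ⊆ E) : PathIn G a b U' E' := by
  obtain ⟨w, hw, hU', hE'⟩ := h
  exact ⟨w, hw, fun v hv => hU (hU' v hv), fun e he => hE' e (hE he)⟩

theorem trans (h : PathIn G a b U E) (h' : PathIn G b c U' E')
    (hUU' : ∀ v ∈ U, v ∈ U' → v = b) : PathIn G a c (U ∪ U') (E ∪ E') := by
  obtain ⟨w, hw, hU, hE⟩ := h
  obtain ⟨w', hw', hU', hE'⟩ := h'
  refine ⟨w.append w', isPath_append hw hw' fun v hv hv' => hUU' v (hU v hv) (hU' v hv'),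
    fun v hv => ?_, fun e he => ?_⟩
  · rcases Walk.mem_support_append_iff _ _ |>.1 hv with h | h
    · exact .inl (hU v h)
    · exact .inr (hU' v h)
  · rw [Walk.edges_append, List.mem_append]
    rcases he with h | h
    · exact .inl (hE e h)
    · exact .inr (hE' e h)

end PathIn

theorem pathIn_row (i : ℕ) {j j' : ℕ} (h : j ≤ j') :
    PathIn gridGraph (i, j) (i, j') {p | p.1 = i ∧ j ≤ p.2 ∧ p.2 ≤ j'}
      {e | ∃ u, j ≤ u ∧ u < j' ∧ e = s((i, u), (i, u + 1))} := by
  obtain ⟨w, hw, hs, he⟩ := exists_path_of_seq (G := gridGraph) (fun u => (i, u)) h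
    (fun u _ _ => by simp [gridGraph]) (fun u u' _ h _ => by simp; omega)
  refine ⟨w, hw, fun v hv => ?_, ?_⟩
  · obtain ⟨u, h1, h2, rfl⟩ := (hs v).1 hv
    exact ⟨rfl, h1, h2⟩
  · rintro e ⟨u, h1, h2, rfl⟩
    exact he u h1 h2

theorem pathIn_col (j : ℕ) {i i' : ℕ} (h : i ≤ i') :
    PathIn gridGraph (i, j) (i', j) {p | p.2 = j ∧ i ≤ p.1 ∧ p.1 ≤ i'}
      {e | ∃ u, i ≤ u ∧ u < i' ∧ e = s((u, j), (u + 1, j))} := by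
  obtain ⟨w, hw, hs, he⟩ := exists_path_of_seq (G := gridGraph) (fun u => (u, j)) h
    (fun u _ _ => by simp [gridGraph]) (fun u u' _ h _ => by simp; omega)
  refine ⟨w, hw, fun v hv => ?_, ?_⟩
  · obtain ⟨u, h1, h2, rfl⟩ := (hs v).1 hv
    exact ⟨rfl, h1, h2⟩
  · rintro e ⟨u, h1, h2, rfl⟩
    exact he u h1 h2

/-- A detour from column `x` along row `f` to column `y` and back along row `f + 1`. -/
theorem pathIn_finger (f : ℕ) {x y : ℕ} (h : x < y) :
    PathIn gridGraph (f, x) (f + 1, x) {p | f ≤ p.1 ∧ p.1 ≤ f + 1 ∧ x ≤ p.2 ∧ p.2 ≤ y}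
      {e | ∃ i u, (i = f ∨ i = f + 1) ∧ x ≤ u ∧ u < y ∧ e = s((i, u), (i, u + 1))} := by
  have h1 := (pathIn_row f h.le).trans (pathIn_col y (Nat.le_add_right f 1)) (by
    rintro ⟨p, q⟩ ⟨h1, h2, h3⟩ ⟨h4, h5, h6⟩
    simp only [Prod.mk.injEq] at *
    omega)
  have h2 := h1.trans (pathIn_row (f + 1) h.le).symm (by
    rintro ⟨p, q⟩ (⟨h1, h2, h3⟩ | ⟨h1, h2, h3⟩) ⟨h4, h5, h6⟩ <;>
    · simp only [Prod.mk.injEq] at *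
      omega)
  refine h2.mono ?_ ?_
  · rintro ⟨p, q⟩ ((⟨h1, h2, h3⟩ | ⟨h1, h2, h3⟩) | ⟨h1, h2, h3⟩) <;>
    · simp only [Set.mem_ofPred_eq] at *
      omega
  · rintro e ⟨i, u, rfl | rfl, h1, h2, rfl⟩
    · exact .inl (.inl ⟨u, h1, h2, rfl⟩)
    · exact .inr ⟨u, h1, h2, rfl⟩

/-- A path down column `x` which, for every `f ∈ F`, replaces the edge between rows `f` and
`f + 1` by a detour to column `y`. -/
theorem pathIn_slab_aux {x y : ℕ} {F : Set ℕ} (hxy : ∀ f ∈ F, x < y)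
    (hF : ∀ f ∈ F, f + 1 ∉ F) (n : ℕ) :
    PathIn gridGraph (0, x) (n, x)
      {p | x ≤ p.2 ∧ (p.2 = x ∨ p.2 ≤ y) ∧ p.1 ≤ n ∧
        (p.2 = x ∨ ∃ f ∈ F, f < n ∧ f ≤ p.1 ∧ p.1 ≤ f + 1)}
      {e | (∃ g < n, g ∉ F ∧ e = s((g, x), (g + 1, x))) ∨
        ∃ f ∈ F, f < n ∧ ∃ i u, (i = f ∨ i = f + 1) ∧ x ≤ u ∧ u < y ∧
          e = s((i, u), (i, u + 1))} := by
  induction n with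
  | zero =>
    refine (pathIn_row 0 (le_refl x)).mono ?_ ?_
    · rintro ⟨p, q⟩ ⟨h1, h2, h3⟩
      simp only [Set.mem_ofPred_eq] at *
      have : q = x := by omega
      omega
    · rintro e (⟨g, h, _⟩ | ⟨f, _, h, _⟩) <;> omega
  | succ n ih =>
    by_cases hn : n ∈ F
    · refine (ih.trans (pathIn_finger n (hxy n hn)) ?_).mono ?_ ?_
      · rintro ⟨p, q⟩ ⟨h1, h2, h3, h4⟩ ⟨h5, h6, h7, h8⟩
        simp only [Prod.mk.injEq] at *
        rcases h4 with h4 | ⟨f, hf, h9, h10, h11⟩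
        · omega
        -- An earlier detour reaches row `n` only if it uses the rows `n - 1` and `n`, and `hF`
        -- forbids two such adjacent detours.
        · have : n = f + 1 := by omega
          exact absurd (this ▸ hn) (hF f hf)
      · rintro ⟨p, q⟩ (⟨h1, h2, h3, h4⟩ | ⟨h5, h6, h7, h8⟩)
        · refine ⟨h1, h2, by simp only at *; omega, ?_⟩
          rcases h4 with h4 | ⟨f, hf, h9, h10, h11⟩
          · exact .inl h4
          · exact .inr ⟨f, hf, by omega, h10, h11⟩
        · exact ⟨h7, .inr h8, h6, .inr ⟨n, hn, by omega, h5, h6⟩⟩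
      · rintro e (⟨g, h, hg, rfl⟩ | ⟨f, hf, h, he⟩)
        · rcases Nat.lt_succ_iff_lt_or_eq.1 h with h | rfl
          · exact .inl (.inl ⟨g, h, hg, rfl⟩)
          · exact absurd hn hg
        · rcases Nat.lt_succ_iff_lt_or_eq.1 h with h | rfl
          · exact .inl (.inr ⟨f, hf, h, he⟩)
          · exact .inr he
    · refine (ih.trans (pathIn_col x (Nat.le_add_right n 1)) ?_).mono ?_ ?_
      · rintro ⟨p, q⟩ ⟨h1, h2, h3, h4⟩ ⟨h5, h6, h7⟩
        simp only [Prod.mk.injEq] at *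
        omega
      · rintro ⟨p, q⟩ (⟨h1, h2, h3, h4⟩ | ⟨h5, h6, h7⟩)
        · refine ⟨h1, h2, by simp only at *; omega, ?_⟩
          rcases h4 with h4 | ⟨f, hf, h9, h10, h11⟩
          · exact .inl h4
          · exact .inr ⟨f, hf, by omega, h10, h11⟩
        · exact ⟨h5.ge, .inl h5, h7, .inl h5⟩
      · rintro e (⟨g, h, hg, rfl⟩ | ⟨f, hf, h, he⟩)
        · rcases Nat.lt_succ_iff_lt_or_eq.1 h with h | rfl
          · exact .inl (.inl ⟨g, h, hg, rfl⟩)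
          · exact .inr ⟨g, le_rfl, by omega, rfl⟩
        · rcases Nat.lt_succ_iff_lt_or_eq.1 h with h | rfl
          · exact .inl (.inr ⟨f, hf, h, he⟩)
          · exact absurd hf hn

theorem PathIn.of_ends {h e x : ℕ} {U : Set (ℕ × ℕ)} {E : Set (Sym2 (ℕ × ℕ))}
    (he : e = 0 ∨ e = h) (hp : PathIn gridGraph (0, x) (h, x) U E) :
    PathIn gridGraph (e, x) (h - e, x) U E := by
  rcases he with rfl | rfl
  · exact hp
  · rw [Nat.sub_self]
    exact hp.symm

/-- The slab of columns `x, …, c - 1`, crossed from row `0` to row `h` or from row `h` to row `0`. -/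
theorem pathIn_slab {x c h e : ℕ} {F : Set ℕ} (he : e = 0 ∨ e = h) (hxc : x < c) (hxy : ∀ f ∈ F, x + 1 < c)
    (hF : ∀ f ∈ F, 1 ≤ f ∧ f + 1 < h ∧ f + 1 ∉ F) :
    PathIn gridGraph (e, x) (h - e, x)
      {p | x ≤ p.2 ∧ p.2 < c ∧ p.1 ≤ h ∧ (p.1 = 0 ∨ p.1 = h → p.2 = x)}
      {e | (∃ g < h, g ∉ F ∧ e = s((g, x), (g + 1, x))) ∨
        ∃ f ∈ F, ∃ i u, (i = f ∨ i = f + 1) ∧ x ≤ u ∧ u + 1 < c ∧ e = s((i, u), (i, u + 1))} := by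
  refine PathIn.mono (PathIn.of_ends he (pathIn_slab_aux (y := c - 1) (F := F) (x := x)
    (fun f hf => by have := hxy f hf; omega) (fun f hf => (hF f hf).2.2) h)) ?_ ?_
  · rintro ⟨p, q⟩ ⟨h1, h2, h3, h4⟩
    simp only at *
    refine ⟨h1, by simp only; omega, h3, fun h5 => ?_⟩
    rcases h4 with h4 | ⟨f, hf, h6, h7, h8⟩
    · exact h4
    · have := hF f hf
      simp only at h5
      omega
  · rintro e (⟨g, h1, h2, rfl⟩ | ⟨f, hf, i, u, h1, h2, h3, rfl⟩)
    · exact .inl ⟨g, h1, h2, rfl⟩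
    · exact .inr ⟨f, hf, by have := hF f hf; omega, i, u, h1, h2, by omega, rfl⟩

/-- A path of the grid with rows `0, …, h` and columns `0, …, c - 1` that runs through all columns
of `X`, where the column `x` is traversed with a detour for every `f ∈ F x`; the detour
covers the part of the rows `f` and `f + 1` from `x` up to the next column of `X`. -/
theorem pathIn_snake {h : ℕ} {F : ℕ → Set ℕ} (X : Finset ℕ) :
    ∀ c : ℕ, 0 ∈ X → (∀ x ∈ X, x < c) →
    (∀ x ∈ X, ∀ f ∈ F x, x + 1 < c ∧ (∀ x' ∈ X, x < x' → x + 1 < x') ∧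
      1 ≤ f ∧ f + 1 < h ∧ f + 1 ∉ F x) →
    ∃ m ∈ X, ∃ e, (e = 0 ∨ e = h) ∧
      PathIn gridGraph (0, 0) (e, m)
        {p | p.1 ≤ h ∧ p.2 < c ∧ (p.1 = e → p.2 ≤ m)}
        {s | (∃ x ∈ X, ∃ g < h, g ∉ F x ∧ s = s((g, x), (g + 1, x))) ∨
          ∃ x ∈ X, ∃ f ∈ F x, ∃ i u, (i = f ∨ i = f + 1) ∧ x ≤ u ∧ u + 1 < c ∧
            (∀ x' ∈ X, x < x' → u + 1 < x') ∧ s = s((i, u), (i, u + 1))} := by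
  induction X using Finset.induction_on_max with
  | empty => simp
  | insert a X ha ih =>
    intro c h0 hc hF
    have haF : ∀ f ∈ F a, 1 ≤ f ∧ f + 1 < h ∧ f + 1 ∉ F a :=
      fun f hf => (hF a (by simp) f hf).2.2
    have hslab {e : ℕ} (he : e = 0 ∨ e = h) := pathIn_slab he (hc a (by simp)) (fun f hf => (hF a (by simp) f hf).1) haF
    rcases X.eq_empty_or_nonempty with rfl | ⟨z, hz⟩
    · obtain rfl : 0 = a := by simpa using h0
      refine ⟨0, by simp, h, .inr rfl, (hslab (.inl rfl)).mono ?_ ?_⟩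
      · rintro ⟨p, q⟩ ⟨h1, h2, h3, h4⟩
        exact ⟨h3, h2, fun h5 => (h4 (.inr h5)).le⟩
      · rintro s (⟨x, hx, g, h1, h2, rfl⟩ | ⟨x, hx, f, hf, i, u, h1, h2, h3, _, rfl⟩)
        · obtain rfl : x = 0 := by simpa using hx
          exact .inl ⟨g, h1, h2, rfl⟩
        · obtain rfl : x = 0 := by simpa using hx
          exact .inr ⟨f, hf, i, u, h1, h2, h3, rfl⟩
    · have haz := ha z hz
      have h0X : 0 ∈ X := by
        rcases Finset.mem_insert.1 h0 with h1 | h1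
        · omega
        · exact h1
      obtain ⟨m, hm, e, he, hp⟩ := ih a h0X ha (fun x hx f hf => by
        obtain ⟨h1, h2, h3⟩ := hF x (by simp [hx]) f hf
        exact ⟨h2 a (by simp) (ha x hx), fun x' hx' => h2 x' (by simp [hx']), h3⟩)
      have hma := ha m hm
      -- Row `e` is free to the right of column `m`, so it carries the link to column `a`. The
      -- earlier part stays in columns before `a`, and the new slab touches the rows `0` and `h`
      -- only in column `a`. Hence row `h - e` is free to the right of `a`, and the construction can
      -- continue from there.
      have hp1 := hp.trans (pathIn_row e hma.le) (by
        rintro ⟨p, q⟩ ⟨h1, h2, h3⟩ ⟨h4, h5, h6⟩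
        simp only [Prod.mk.injEq] at *
        omega)
      have hp3 := hp1.trans (hslab he) (by
        rintro ⟨p, q⟩ (⟨h1, h2, h3⟩ | ⟨h1, h2, h3⟩) ⟨h4, h5, h6, h7⟩ <;>
        · simp only [Prod.mk.injEq] at *
          omega)
      refine ⟨a, by simp, h - e, by omega, hp3.mono ?_ ?_⟩
      · have hac := hc a (by simp)
        rintro ⟨p, q⟩ ((⟨h1, h2, h3⟩ | ⟨h1, h2, h3⟩) | ⟨h4, h5, h6, h7⟩) <;>
        · simp only [Set.mem_ofPred_eq] at *
          omega
      · rintro s (⟨x, hx, g, h1, h2, rfl⟩ | ⟨x, hx, f, hf, i, u, h1, h2, h3, h4, rfl⟩)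
        · rcases Finset.mem_insert.1 hx with rfl | hx
          · exact .inr (.inl ⟨g, h1, h2, rfl⟩)
          · exact .inl (.inl (.inl ⟨x, hx, g, h1, h2, rfl⟩))
        · rcases Finset.mem_insert.1 hx with rfl | hx
          · exact .inr (.inr ⟨f, hf, i, u, h1, h2, h3, rfl⟩)
          · exact .inl (.inl (.inr ⟨x, hx, f, hf, i, u, h1, h2, h4 a (by simp) (ha x hx),
              fun x' hx' => h4 x' (by simp [hx']), rfl⟩))

/-! ### Lifting a path through cells and segments -/

/-- Replacing the vertices of a path by cells and its edges by segments joining the cells. -/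
theorem exists_lift {V W : Type*} {G : SimpleGraph V} {Γ : SimpleGraph W} (B : Set W)
    (att : W → W → V) (seg : W → W → Set V) (cell : W → Set V) (str : W → W → W → Prop)
    (hsegsymm : ∀ x y, seg x y = seg y x) (hstrsymm : ∀ x y z, str x y z → str z y x)
    (hseg : ∀ x ∈ B, ∀ y ∈ B, Γ.Adj x y → ∃ g : G.Walk (att x y) (att y x), g.IsPath ∧
      ∀ v, v ∈ g.support ↔ v ∈ seg x y)
    (hcell : ∀ x ∈ B, ∀ y ∈ B, ∀ z ∈ B, Γ.Adj x y → Γ.Adj y z → x ≠ z →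
      ∃ g : G.Walk (att y x) (att y z), g.IsPath ∧ (∀ v ∈ g.support, v ∈ cell y) ∧
        (str x y z → ∀ v ∈ cell y, v ∈ g.support))
    (hcc : ∀ x ∈ B, ∀ y ∈ B, ∀ v ∈ cell x, v ∈ cell y → x = y)
    (hsc : ∀ x ∈ B, ∀ y ∈ B, Γ.Adj x y → ∀ z ∈ B, ∀ v ∈ seg x y, v ∈ cell z →
      (z = x ∧ v = att x y) ∨ (z = y ∧ v = att y x))
    (hss : ∀ x ∈ B, ∀ y ∈ B, Γ.Adj x y → ∀ x' ∈ B, ∀ y' ∈ B, Γ.Adj x' y' →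
      ∀ v ∈ seg x y, v ∈ seg x' y' → s(x, y) = s(x', y') ∨ ∃ z ∈ B, v ∈ cell z)
    {y z : W} (w : Γ.Walk y z) :
    w.IsPath → (∀ u ∈ w.support, u ∈ B) → ∀ x ∈ B, Γ.Adj x y → x ∉ w.support →
    ∃ b, ∃ g : G.Walk (att x y) b, g.IsPath ∧
      (∀ v ∈ g.support, (∃ u u', s(u, u') ∈ s(x, y) :: w.edges ∧ v ∈ seg u u') ∨
        ∃ u ∈ w.support, v ∈ cell u) ∧
      (∀ u u', s(u, u') ∈ s(x, y) :: w.edges → ∀ v ∈ seg u u', v ∈ g.support) ∧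
      (∀ u u' u'', s(u, u') ∈ s(x, y) :: w.edges → s(u', u'') ∈ s(x, y) :: w.edges →
        u ≠ u'' → str u u' u'' → ∀ v ∈ cell u', v ∈ g.support) := by
  have key : ∀ {u u' x y v}, s(u, u') = s(x, y) → v ∈ seg u u' → v ∈ seg x y := by
    intro u u' x y v h hv
    rcases Sym2.eq_iff.1 h with ⟨rfl, rfl⟩ | ⟨rfl, rfl⟩
    · exact hv
    · rwa [hsegsymm]
  -- The edge `xy` in front of the walk is part of the induction: the lifted path starts with its
  -- segment, crosses the cell of `y`, and goes on with the lift of the remaining walk. The first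
  -- and the last cell are never crossed.
  induction w with
  | @nil y =>
    intro _ hB x hx hxy hxw
    obtain ⟨g, hg, hs⟩ := hseg x hx y (hB y (by simp)) hxy
    refine ⟨_, g, hg, fun v hv => .inl ⟨x, y, by simp, (hs v).1 hv⟩, fun u u' h v hv => ?_, ?_⟩
    · rw [hs]
      exact key (by simpa using h) hv
    · intro u u' u'' h h' hne
      simp only [Walk.edges_nil, List.mem_singleton] at h h'
      rw [← h', Sym2.eq_swap, Sym2.congr_right] at h
      exact absurd h hne
  | @cons y y' z hyy' w ih =>
    intro hw hB x hx hxy hxw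
    rw [Walk.cons_isPath_iff] at hw
    have hyB : y ∈ B := hB y (by simp)
    have hwB : ∀ u ∈ w.support, u ∈ B := fun u hu => hB u (by simp [hu])
    have hy'B : y' ∈ B := hwB y' (by simp)
    have hxw' : x ∉ w.support := fun h => hxw (by simp [h])
    have hxney : x ≠ y := hxy.ne
    have hxy' : x ≠ y' := fun h => hxw' (by simp [h])
    obtain ⟨b, g, hg, hgU, hgs, hgc⟩ := ih hw.1 hwB y hyB hyy' hw.2
    obtain ⟨g₁, hg₁, hs₁⟩ := hseg x hx y hyB hxy
    obtain ⟨g₂, hg₂, hU₂, hs₂⟩ := hcell x hx y hyB y' hy'B hxy hyy' hxy'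
    have hedge : ∀ {u u'}, s(u, u') ∈ w.edges →
        u ∈ w.support ∧ u' ∈ w.support ∧ Γ.Adj u u' := fun h =>
      ⟨w.fst_mem_support_of_mem_edges h, w.snd_mem_support_of_mem_edges h,
        w.adj_of_mem_edges h⟩
    have h23 : ∀ v ∈ g₂.support, v ∈ g.support → v = att y y' := by
      intro v hv hv'
      have hvy := hU₂ v hv
      rcases hgU v hv' with ⟨u, u', hu, hvu⟩ | ⟨u, hu, hvu⟩
      · rcases List.mem_cons.1 hu with hu | hu
        · rcases hsc y hyB y' hy'B hyy' y hyB v (key hu hvu) hvy with ⟨_, h⟩ | ⟨h, _⟩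
          · exact h
          · exact absurd h hyy'.ne
        · obtain ⟨h1, h2, h3⟩ := hedge hu
          rcases hsc u (hwB u h1) u' (hwB u' h2) h3 y hyB v hvu hvy with ⟨h, _⟩ | ⟨h, _⟩
          · exact absurd (h ▸ h1) hw.2
          · exact absurd (h ▸ h2) hw.2
      · exact absurd (hcc y hyB u (hwB u hu) v hvy hvu ▸ hu) hw.2
    have hxyc : ∀ v ∈ seg x y, v ∈ cell y → v = att y x := by
      intro v hv hv'
      rcases hsc x hx y hyB hxy y hyB v hv hv' with ⟨h, _⟩ | ⟨_, h⟩
      · exact absurd h.symm hxney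
      · exact h
    -- A vertex shared by two different segments lies in a cell by `hss`, and by `hsc` that cell is
    -- an end of both edges. As neither `x` nor `y` occurs on `w`, only the edge `yy'` can share an
    -- end with `xy`, namely `y`, and the common vertex is then `att y x`.
    have h13 : ∀ v ∈ g₁.support, v ∈ (g₂.append g).support → v = att y x := by
      intro v hv hv'
      rw [hs₁] at hv
      rcases (Walk.mem_support_append_iff _ _).1 hv' with hv' | hv'
      · exact hxyc v hv (hU₂ v hv')
      rcases hgU v hv' with ⟨u, u', hu, hvu⟩ | ⟨u, hu, hvu⟩
      · rcases List.mem_cons.1 hu with hu | hu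
        · have hvu' := key hu hvu
          rcases hss x hx y hyB hxy y hyB y' hy'B hyy' v hv hvu' with h | ⟨z, hz, hvz⟩
          · rw [Sym2.eq_swap, Sym2.congr_right] at h
            exact absurd h hxy'
          · rcases hsc x hx y hyB hxy z hz v hv hvz with ⟨rfl, _⟩ | ⟨_, h⟩
            · rcases hsc y hyB y' hy'B hyy' z hz v hvu' hvz with ⟨h, _⟩ | ⟨h, _⟩
              · exact absurd h hxney
              · exact absurd h hxy'
            · exact h
        · obtain ⟨h1, h2, h3⟩ := hedge hu
          rcases hss x hx y hyB hxy u (hwB u h1) u' (hwB u' h2) h3 v hv hvu with h | ⟨z, hz, hvz⟩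
          · rcases Sym2.eq_iff.1 h with ⟨rfl, _⟩ | ⟨rfl, _⟩
            · exact absurd h1 hxw'
            · exact absurd h2 hxw'
          · have hzw : z ∈ w.support := by
              rcases hsc u (hwB u h1) u' (hwB u' h2) h3 z hz v hvu hvz with ⟨rfl, _⟩ | ⟨rfl, _⟩
              · exact h1
              · exact h2
            rcases hsc x hx y hyB hxy z hz v hv hvz with ⟨rfl, _⟩ | ⟨rfl, _⟩
            · exact absurd hzw hxw'
            · exact absurd hzw hw.2
      · rcases hsc x hx y hyB hxy u (hwB u hu) v hv hvu with ⟨rfl, _⟩ | ⟨rfl, _⟩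
        · exact absurd hu hxw'
        · exact absurd hu hw.2
    have hsub : ∀ v, (v ∈ g₁.support ∨ v ∈ g₂.support ∨ v ∈ g.support) →
        v ∈ (g₁.append (g₂.append g)).support := fun v hv => by
      simpa only [Walk.mem_support_append_iff] using hv
    -- The only edge at `x` is `xy`, and `yy'` is the only other edge at `y`. So two consecutive
    -- edges are either `xy` and `yy'`, in one of the two directions, and their common cell is
    -- handled by `g₂`, or they belong to the walk covered by the induction hypothesis.
    have hx_mem : ∀ {u}, s(x, u) ∈ s(x, y) :: s(y, y') :: w.edges → u = y := by
      intro u h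
      rcases List.mem_cons.1 h with h | h
      · exact Sym2.congr_right.1 h
      · rcases List.mem_cons.1 h with h | h
        · rcases Sym2.eq_iff.1 h with ⟨h, _⟩ | ⟨h, _⟩
          · exact absurd h hxney
          · exact absurd h hxy'
        · exact absurd (hedge h).1 hxw'
    have hy_mem : ∀ {u}, s(y, u) ∈ s(x, y) :: s(y, y') :: w.edges → u ≠ x → u = y' := by
      intro u h hu
      rcases List.mem_cons.1 h with h | h
      · rw [Sym2.eq_swap, Sym2.congr_left] at h
        exact absurd h hu
      · rcases List.mem_cons.1 h with h | h
        · exact Sym2.congr_right.1 h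
        · exact absurd (hedge h).1 hw.2
    refine ⟨b, g₁.append (g₂.append g), isPath_append hg₁ (isPath_append hg₂ hg h23) h13,
      fun v hv => ?_, fun u u' hu v hv => hsub v ?_, fun u u' u'' hu hu' hne hstr v hv => hsub v ?_⟩
    · rw [Walk.mem_support_append_iff, Walk.mem_support_append_iff] at hv
      rcases hv with hv | hv | hv
      · exact .inl ⟨x, y, by simp, (hs₁ v).1 hv⟩
      · exact .inr ⟨y, by simp, hU₂ v hv⟩
      · rcases hgU v hv with ⟨u, u', hu, hvu⟩ | ⟨u, hu, hvu⟩
        · exact .inl ⟨u, u', by rw [Walk.edges_cons]; exact List.mem_cons_of_mem _ hu, hvu⟩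
        · exact .inr ⟨u, by simp [hu], hvu⟩
    · rw [Walk.edges_cons] at hu
      rcases List.mem_cons.1 hu with hu | hu
      · exact .inl ((hs₁ v).2 (key hu hv))
      · exact .inr (.inr (hgs u u' hu v hv))
    · rw [Walk.edges_cons] at hu hu'
      by_cases hux : u = x
      · subst hux
        obtain rfl := hx_mem hu
        obtain rfl := hy_mem hu' hne.symm
        exact .inr (.inl (hs₂ hstr v hv))
      by_cases hu''x : u'' = x
      · subst hu''x
        rw [(Sym2.eq_swap : s(u', u'') = s(u'', u'))] at hu'
        obtain rfl := hx_mem hu'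
        rw [(Sym2.eq_swap : s(u, u') = s(u', u))] at hu
        obtain rfl := hy_mem hu hne
        exact .inr (.inl (hs₂ (hstrsymm _ _ _ hstr) v hv))
      · have hx' : u' ≠ x := by
          rintro rfl
          rw [(Sym2.eq_swap : s(u, u') = s(u', u))] at hu
          exact hne ((hx_mem hu).trans (hx_mem hu').symm)
        have aux : ∀ {p q}, s(p, q) ∈ s(x, y) :: s(y, y') :: w.edges → p ≠ x → q ≠ x →
            s(p, q) ∈ s(y, y') :: w.edges := by
          intro p q h hp hq
          rcases List.mem_cons.1 h with h | h
          · rcases Sym2.eq_iff.1 h with ⟨h, _⟩ | ⟨_, h⟩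
            · exact absurd h hp
            · exact absurd h hq
          · exact h
        exact .inr (.inr (hgc u u' u'' (aux hu hux hx') (aux hu' hx' hu''x) hne hstr v hv))

/-! ### Positions on a path -/

namespace GPath

variable {V : Type*} {G : SimpleGraph V} (p : GPath G)

theorem vert_mem {t : ℕ} : p.vert t ∈ p.verts := p.walk.getVert_mem_support t

theorem exists_vert {v : V} (hv : v ∈ p.verts) : ∃ t ≤ p.length, p.vert t = v := by
  obtain ⟨t, h, h'⟩ := Walk.mem_support_iff_exists_getVert.1 hv
  exact ⟨t, h', h⟩

theorem adj {t : ℕ} (h : t < p.length) : G.Adj (p.vert t) (p.vert (t + 1)) :=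
  p.walk.adj_getVert_succ h

theorem vert_inj {t t' : ℕ} (h : t ≤ p.length) (h' : t' ≤ p.length)
    (e : p.vert t = p.vert t') : t = t' :=
  p.isPath.getVert_injOn h h' e

theorem exists_subpath {s t : ℕ} (hst : s ≤ t) (ht : t ≤ p.length) :
    ∃ w : G.Walk (p.vert s) (p.vert t), w.IsPath ∧
      ∀ v, v ∈ w.support ↔ ∃ u, s ≤ u ∧ u ≤ t ∧ p.vert u = v := by
  obtain ⟨w, hw, hs, -⟩ := exists_path_of_seq p.vert hst (fun u _ h => p.adj (by omega))
    (fun u u' _ h h' e => by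
      have := p.vert_inj (by omega) (by omega) e
      omega)
  exact ⟨w, hw, hs⟩

end GPath

/-! ### Grids of rows and columns -/

/-- The rows `P i`, `i ∈ R`, and the columns `Q j`, `j ∈ C`, form a grid: row `i` and column `j`
meet in a common subpath, which lies at the positions from `pl i j` to `pu i j` of `P i` and at
the positions from `ql j i` to `qu j i` of `Q j`, and rows and columns meet in no other vertices
between their first and last crossings. -/
structure IsGrid {V I J : Type*} [LinearOrder I] [LinearOrder J] {G : SimpleGraph V}
    (P : I → GPath G) (Q : J → GPath G) (R : Finset I) (C : Finset J)
    (pl pu : I → J → ℕ) (ql qu : J → I → ℕ) : Prop where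
  disjoint_left : ∀ i ∈ R, ∀ i' ∈ R, i ≠ i' → Disjoint (P i).verts (P i').verts
  disjoint_right : ∀ j ∈ C, ∀ j' ∈ C, j ≠ j' → Disjoint (Q j).verts (Q j').verts
  pu_le : ∀ i ∈ R, ∀ j ∈ C, pu i j ≤ (P i).length
  qu_le : ∀ j ∈ C, ∀ i ∈ R, qu j i ≤ (Q j).length
  pu_lt : ∀ i ∈ R, ∀ j ∈ C, ∀ j' ∈ C, j < j' → pu i j < pl i j'
  qu_lt : ∀ j ∈ C, ∀ i ∈ R, ∀ i' ∈ R, i < i' → qu j i < ql j i'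
  cell : ∀ i ∈ R, ∀ j ∈ C, ∃ d, pu i j = pl i j + d ∧ qu j i = ql j i + d ∧
    ((∀ x ≤ d, (P i).vert (pl i j + x) = (Q j).vert (ql j i + x)) ∨
      ∀ x ≤ d, (P i).vert (pl i j + x) = (Q j).vert (ql j i + (d - x)))
  inter : ∀ i ∈ R, ∀ j ∈ C, ∀ i₁ ∈ R, ∀ i₂ ∈ R, ∀ j₁ ∈ C, ∀ j₂ ∈ C, ∀ t s,
    pl i j₁ ≤ t → t ≤ pu i j₂ → ql j i₁ ≤ s → s ≤ qu j i₂ → (P i).vert t = (Q j).vert s →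
    ql j i ≤ s ∧ s ≤ qu j i

namespace IsGrid

section

variable {V I J : Type*} [LinearOrder I] [LinearOrder J] {G : SimpleGraph V}
  {P : I → GPath G} {Q : J → GPath G} {R : Finset I} {C : Finset J}
  {pl pu : I → J → ℕ} {ql qu : J → I → ℕ}

/-- The cell matches each of its column positions with a row position, and a row has no repeated
vertex. This transfers the conclusion of the field `inter` from columns to rows. -/
theorem inter_left (H : IsGrid P Q R C pl pu ql qu) {i : I} {j : J} (hi : i ∈ R) (hj : j ∈ C)
    {t s : ℕ} (ht : t ≤ (P i).length) (h : ql j i ≤ s) (h' : s ≤ qu j i)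
    (e : (P i).vert t = (Q j).vert s) : pl i j ≤ t ∧ t ≤ pu i j := by
  obtain ⟨d, h1, h2, h3⟩ := H.cell i hi j hj
  have hpu := H.pu_le i hi j hj
  rcases h3 with h3 | h3
  · have h4 := h3 (s - ql j i) (by omega)
    rw [show ql j i + (s - ql j i) = s by omega, ← e] at h4
    have := (P i).vert_inj (by omega) ht h4
    omega
  · have h4 := h3 (d - (s - ql j i)) (by omega)
    rw [show ql j i + (d - (d - (s - ql j i))) = s by omega, ← e] at h4
    have := (P i).vert_inj (by omega) ht h4
    omega

/-- The definition is asymmetric in form only: reversing a cell is an involution, and `inter_left`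
gives the missing half of `inter`. Every fact on rows thereby holds for columns too. -/
theorem swap (H : IsGrid P Q R C pl pu ql qu) : IsGrid Q P C R ql qu pl pu where
  disjoint_left := H.disjoint_right
  disjoint_right := H.disjoint_left
  pu_le := H.qu_le
  qu_le := H.pu_le
  pu_lt := H.qu_lt
  qu_lt := H.pu_lt
  cell j hj i hi := by
    obtain ⟨d, h1, h2, h3⟩ := H.cell i hi j hj
    refine ⟨d, h2, h1, ?_⟩
    rcases h3 with h3 | h3
    · exact .inl fun x hx => (h3 x hx).symm
    · refine .inr fun x hx => ?_
      rw [h3 (d - x) (by omega), show d - (d - x) = x by omega]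
  inter j hj i hi j₁ hj₁ j₂ hj₂ i₁ hi₁ i₂ hi₂ s t h1 h2 h3 h4 e := by
    have h5 := H.inter i hi j hj i₁ hi₁ i₂ hi₂ j₁ hj₁ j₂ hj₂ t s h3 h4 h1 h2 e.symm
    exact H.inter_left hi hj (h4.trans (H.pu_le i hi j₂ hj₂)) h5.1 h5.2 e.symm

theorem mono (H : IsGrid P Q R C pl pu ql qu) {R' : Finset I} {C' : Finset J} (hR : R' ⊆ R)
    (hC : C' ⊆ C) : IsGrid P Q R' C' pl pu ql qu where
  disjoint_left i hi i' hi' := H.disjoint_left i (hR hi) i' (hR hi')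
  disjoint_right j hj j' hj' := H.disjoint_right j (hC hj) j' (hC hj')
  pu_le i hi j hj := H.pu_le i (hR hi) j (hC hj)
  qu_le j hj i hi := H.qu_le j (hC hj) i (hR hi)
  pu_lt i hi j hj j' hj' := H.pu_lt i (hR hi) j (hC hj) j' (hC hj')
  qu_lt j hj i hi i' hi' := H.qu_lt j (hC hj) i (hR hi) i' (hR hi')
  cell i hi j hj := H.cell i (hR hi) j (hC hj)
  inter i hi j hj i₁ hi₁ i₂ hi₂ j₁ hj₁ j₂ hj₂ := H.inter i (hR hi) j (hC hj)
    i₁ (hR hi₁) i₂ (hR hi₂) j₁ (hC hj₁) j₂ (hC hj₂)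

/-- Used to number the rows and columns by initial segments of `ℕ`, so that the cells become
vertices of `gridGraph`. -/
theorem comp (H : IsGrid P Q R C pl pu ql qu) {I' J' : Type*} [LinearOrder I'] [LinearOrder J']
    {R' : Finset I'} {C' : Finset J'} {ρ : I' → I} {γ : J' → J} (hρ : ∀ i ∈ R', ρ i ∈ R)
    (hγ : ∀ j ∈ C', γ j ∈ C) (hρ' : ∀ i ∈ R', ∀ i' ∈ R', i < i' → ρ i < ρ i')
    (hγ' : ∀ j ∈ C', ∀ j' ∈ C', j < j' → γ j < γ j') :
    IsGrid (fun i => P (ρ i)) (fun j => Q (γ j)) R' C' (fun i j => pl (ρ i) (γ j))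
      (fun i j => pu (ρ i) (γ j)) (fun j i => ql (γ j) (ρ i)) (fun j i => qu (γ j) (ρ i)) where
  disjoint_left i hi i' hi' h := H.disjoint_left _ (hρ i hi) _ (hρ i' hi') (by
    rcases lt_or_gt_of_ne h with h | h
    · exact (hρ' i hi i' hi' h).ne
    · exact (hρ' i' hi' i hi h).ne')
  disjoint_right j hj j' hj' h := H.disjoint_right _ (hγ j hj) _ (hγ j' hj') (by
    rcases lt_or_gt_of_ne h with h | h
    · exact (hγ' j hj j' hj' h).ne
    · exact (hγ' j' hj' j hj h).ne')
  pu_le i hi j hj := H.pu_le _ (hρ i hi) _ (hγ j hj)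
  qu_le j hj i hi := H.qu_le _ (hγ j hj) _ (hρ i hi)
  pu_lt i hi j hj j' hj' h := H.pu_lt _ (hρ i hi) _ (hγ j hj) _ (hγ j' hj') (hγ' j hj j' hj' h)
  qu_lt j hj i hi i' hi' h := H.qu_lt _ (hγ j hj) _ (hρ i hi) _ (hρ i' hi') (hρ' i hi i' hi' h)
  cell i hi j hj := H.cell _ (hρ i hi) _ (hγ j hj)
  inter i hi j hj i₁ hi₁ i₂ hi₂ j₁ hj₁ j₂ hj₂ := H.inter _ (hρ i hi) _ (hγ j hj)
    _ (hρ i₁ hi₁) _ (hρ i₂ hi₂) _ (hγ j₁ hj₁) _ (hγ j₂ hj₂)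

theorem pl_le (H : IsGrid P Q R C pl pu ql qu) {i : I} {j : J} (hi : i ∈ R) (hj : j ∈ C) :
    pl i j ≤ pu i j := by
  obtain ⟨d, h, -⟩ := H.cell i hi j hj
  omega

theorem pl_mono (H : IsGrid P Q R C pl pu ql qu) {i : I} {j j' : J} (hi : i ∈ R) (hj : j ∈ C)
    (hj' : j' ∈ C) (h : j ≤ j') : pl i j ≤ pl i j' := by
  rcases h.eq_or_lt with rfl | h
  · exact le_rfl
  · exact (H.pl_le hi hj).trans (H.pu_lt i hi j hj j' hj' h).le

theorem pu_mono (H : IsGrid P Q R C pl pu ql qu) {i : I} {j j' : J} (hi : i ∈ R) (hj : j ∈ C)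
    (hj' : j' ∈ C) (h : j ≤ j') : pu i j ≤ pu i j' := by
  rcases h.eq_or_lt with rfl | h
  · exact le_rfl
  · exact (H.pu_lt i hi j hj j' hj' h).le.trans (H.pl_le hi hj')

theorem eq_of_vert_eq (H : IsGrid P Q R C pl pu ql qu) {i i' : I} (hi : i ∈ R) (hi' : i' ∈ R)
    {t t' : ℕ} (ht : t ≤ (P i).length) (ht' : t' ≤ (P i').length)
    (e : (P i).vert t = (P i').vert t') : i = i' ∧ t = t' := by
  have h : i = i' := by
    by_contra h
    exact Set.disjoint_left.1 (H.disjoint_left i hi i' hi' h) (P i).vert_mem (e ▸ (P i').vert_mem)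
  subst h
  exact ⟨rfl, (P i).vert_inj ht ht' e⟩

/-- The common vertices of row `i` and column `j`. -/
def cellSet (P : I → GPath G) (pl pu : I → J → ℕ) (i : I) (j : J) : Set V :=
  {v | ∃ t, pl i j ≤ t ∧ t ≤ pu i j ∧ (P i).vert t = v}

theorem cellSet_swap_subset (H : IsGrid P Q R C pl pu ql qu) {i : I} {j : J} (hi : i ∈ R)
    (hj : j ∈ C) : cellSet P pl pu i j ⊆ cellSet Q ql qu j i := by
  rintro _ ⟨t, h1, h2, rfl⟩
  obtain ⟨d, h3, h4, h5 | h5⟩ := H.cell i hi j hj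
  · refine ⟨ql j i + (t - pl i j), by omega, by omega, ?_⟩
    rw [← h5 _ (by omega)]
    congr 1
    omega
  · refine ⟨ql j i + (d - (t - pl i j)), by omega, by omega, ?_⟩
    rw [← h5 _ (by omega)]
    congr 1
    omega

theorem cellSet_swap (H : IsGrid P Q R C pl pu ql qu) {i : I} {j : J} (hi : i ∈ R)
    (hj : j ∈ C) : cellSet P pl pu i j = cellSet Q ql qu j i :=
  (H.cellSet_swap_subset hi hj).antisymm (H.swap.cellSet_swap_subset hj hi)

theorem cellSet_inj (H : IsGrid P Q R C pl pu ql qu) {i i' : I} {j j' : J} (hi : i ∈ R)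
    (hi' : i' ∈ R) (hj : j ∈ C) (hj' : j' ∈ C) {v : V} (hv : v ∈ cellSet P pl pu i j)
    (hv' : v ∈ cellSet P pl pu i' j') : i = i' ∧ j = j' := by
  have h1 : i = i' := by
    obtain ⟨t, h1, h2, rfl⟩ := hv
    obtain ⟨t', h3, h4, e⟩ := hv'
    exact (H.eq_of_vert_eq hi hi' (h2.trans (H.pu_le i hi j hj))
      (h4.trans (H.pu_le i' hi' j' hj')) e.symm).1
  rw [H.cellSet_swap hi hj] at hv
  rw [H.cellSet_swap hi' hj'] at hv'
  obtain ⟨t, h2, h3, rfl⟩ := hv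
  obtain ⟨t', h4, h5, e⟩ := hv'
  exact ⟨h1, (H.swap.eq_of_vert_eq hj hj' (h3.trans (H.qu_le j hj i hi))
      (h5.trans (H.qu_le j' hj' i' hi')) e.symm).1⟩

/-- Between two crossings, a row meets only cells of columns in between. -/
theorem cellSet_of_vert (H : IsGrid P Q R C pl pu ql qu) {i i' : I} {j j₂ : J} (hi : i ∈ R)
    (hi' : i' ∈ R) (hj : j ∈ C) (hj₂ : j₂ ∈ C) {t : ℕ}
    (h₂ : t ≤ pu i j₂) (hv : (P i).vert t ∈ cellSet P pl pu i' j) :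
    i' = i ∧ pl i j ≤ t ∧ t ≤ pu i j := by
  obtain ⟨t', h1, h2, e⟩ := hv
  obtain ⟨rfl, rfl⟩ := H.eq_of_vert_eq hi' hi (h2.trans (H.pu_le i' hi' j hj))
    (h₂.trans (H.pu_le i hi j₂ hj₂)) e
  exact ⟨rfl, h1, h2⟩

/-- The part of row `i` between the columns `j` and `j'`. -/
def segSet (P : I → GPath G) (pl pu : I → J → ℕ) (i : I) (j j' : J) : Set V :=
  {v | ∃ t, pu i j ≤ t ∧ t ≤ pl i j' ∧ (P i).vert t = v}

theorem exists_seg (H : IsGrid P Q R C pl pu ql qu) {i : I} {j j' : J} (hi : i ∈ R) (hj : j ∈ C)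
    (hj' : j' ∈ C) (h : j < j') :
    ∃ g : G.Walk ((P i).vert (pu i j)) ((P i).vert (pl i j')), g.IsPath ∧
      ∀ v, v ∈ g.support ↔ v ∈ segSet P pl pu i j j' :=
  (P i).exists_subpath (H.pu_lt i hi j hj j' hj' h).le
    ((H.pl_le hi hj').trans (H.pu_le i hi j' hj'))

end

end IsGrid

namespace IsGrid

section

variable {V I J : Type*} [LinearOrder I] [LinearOrder J] {G : SimpleGraph V}
  {P : I → GPath G} {Q : J → GPath G} {R : Finset I} {C : Finset J}
  {pl pu : I → J → ℕ} {ql qu : J → I → ℕ}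

/-- The cells of a row occupy disjoint intervals of positions, in the order of the columns. A column
that is not strictly between `j` and `j'` is therefore reached by the segment at most at one of its
ends. -/
theorem segSet_inter_cellSet (H : IsGrid P Q R C pl pu ql qu) {i i' : I} {j j' k : J}
    (hi : i ∈ R) (hi' : i' ∈ R) (hj : j ∈ C) (hj' : j' ∈ C) (hk : k ∈ C)
    (hcons : k ≤ j ∨ j' ≤ k) {v : V} (hv : v ∈ segSet P pl pu i j j')
    (hv' : v ∈ cellSet P pl pu i' k) :
    i' = i ∧ (k = j ∧ v = (P i).vert (pu i j) ∨ k = j' ∧ v = (P i).vert (pl i j')) := by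
  obtain ⟨t, h1, h2, rfl⟩ := hv
  have hj'' := H.pl_le hi hj'
  have hj3 := H.pl_le hi hj
  obtain ⟨h3, h4, h5⟩ := H.cellSet_of_vert hi hi' hk hj' (h2.trans hj'') hv'
  refine ⟨h3, ?_⟩
  rcases hcons with h | h
  · rcases h.eq_or_lt with rfl | h
    · exact .inl ⟨rfl, by rw [le_antisymm h5 h1]⟩
    · have := H.pu_lt i hi k hk j hj h
      omega
  · rcases h.eq_or_lt with rfl | h
    · exact .inr ⟨rfl, by rw [le_antisymm h4 h2]⟩
    · have := H.pu_lt i hi j' hj' k hk h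
      omega

theorem segSet_inter_segSet_swap (H : IsGrid P Q R C pl pu ql qu) {i i₁ i₂ : I} {j j₁ j₂ : J}
    (hi : i ∈ R) (hi₁ : i₁ ∈ R) (hi₂ : i₂ ∈ R) (hj : j ∈ C) (hj₁ : j₁ ∈ C) (hj₂ : j₂ ∈ C) {v : V}
    (hv : v ∈ segSet P pl pu i j₁ j₂) (hv' : v ∈ segSet Q ql qu j i₁ i₂) :
    v ∈ cellSet P pl pu i j := by
  obtain ⟨t, h1, h2, rfl⟩ := hv
  obtain ⟨s, h3, h4, e⟩ := hv'
  rw [H.cellSet_swap hi hj]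
  have := H.inter i hi j hj i₁ hi₁ i₂ hi₂ j₁ hj₁ j₂ hj₂ t s ((H.pl_le hi hj₁).trans h1)
    (h2.trans (H.pl_le hi hj₂)) ((H.swap.pl_le hj hi₁).trans h3)
    (h4.trans (H.swap.pl_le hj hi₂)) e.symm
  exact ⟨s, this.1, this.2, e⟩

theorem segSet_inter_segSet (H : IsGrid P Q R C pl pu ql qu) {i i' : I} {j₁ j₂ j₁' j₂' : J}
    (hi : i ∈ R) (hi' : i' ∈ R) (hj₂ : j₂ ∈ C) (hj₁' : j₁' ∈ C) (hj₂' : j₂' ∈ C)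
    (hj : j₂ ≤ j₁') {v : V} (hv : v ∈ segSet P pl pu i j₁ j₂)
    (hv' : v ∈ segSet P pl pu i' j₁' j₂') : v ∈ cellSet P pl pu i j₂ := by
  obtain ⟨t, h1, h2, rfl⟩ := hv
  obtain ⟨t', h3, h4, e⟩ := hv'
  obtain ⟨rfl, rfl⟩ := H.eq_of_vert_eq hi hi' ((h2.trans (H.pl_le hi hj₂)).trans
    (H.pu_le i hi j₂ hj₂)) ((h4.trans (H.pl_le hi' hj₂')).trans (H.pu_le i' hi' j₂' hj₂')) e.symm
  have := H.pl_le hi hj₁'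
  have := H.pl_mono hi hj₂ hj₁' hj
  exact ⟨t, by omega, by have := H.pl_le hi hj₂; omega, rfl⟩

/-- A cell is itself a path, so joining two of its ends either traverses it completely or is
trivial. Passing straight along the row is of the first kind; a turn can be of either kind,
depending on the direction in which the column runs through the cell. -/
theorem exists_corner (H : IsGrid P Q R C pl pu ql qu) {i : I} {j : J} (hi : i ∈ R) (hj : j ∈ C)
    {a b : V} (ha : a = (P i).vert (pl i j) ∨ a = (P i).vert (pu i j))
    (hb : b = (P i).vert (pl i j) ∨ b = (P i).vert (pu i j)) :
    ∃ g : G.Walk a b, g.IsPath ∧ (∀ v ∈ g.support, v ∈ cellSet P pl pu i j) ∧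
      ((a = (P i).vert (pl i j) ∧ b = (P i).vert (pu i j) ∨
        a = (P i).vert (pu i j) ∧ b = (P i).vert (pl i j)) →
        ∀ v ∈ cellSet P pl pu i j, v ∈ g.support) := by
  have hle := H.pl_le hi hj
  obtain ⟨g, hg, hs⟩ := (P i).exists_subpath hle (H.pu_le i hi j hj)
  by_cases h1 : a = (P i).vert (pl i j) ∧ b = (P i).vert (pu i j)
  · obtain ⟨rfl, rfl⟩ := h1
    exact ⟨g, hg, fun v hv => (hs v).1 hv, fun _ v hv => (hs v).2 hv⟩
  by_cases h2 : a = (P i).vert (pu i j) ∧ b = (P i).vert (pl i j)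
  · obtain ⟨rfl, rfl⟩ := h2
    exact ⟨g.reverse, hg.reverse, fun v hv => (hs v).1 (by simpa using hv),
      fun _ v hv => by simpa using (hs v).2 hv⟩
  · obtain rfl : a = b := by
      rcases ha with ha | ha <;> rcases hb with hb | hb
      · rw [ha, hb]
      · exact absurd ⟨ha, hb⟩ h1
      · exact absurd ⟨ha, hb⟩ h2
      · rw [ha, hb]
    refine ⟨Walk.nil, Walk.IsPath.nil, fun v hv => ?_, fun h => absurd h (not_or.2 ⟨h1, h2⟩)⟩
    obtain rfl : v = a := by simpa using hv
    rcases ha with ha | ha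
    · exact ⟨_, le_rfl, hle, ha.symm⟩
    · exact ⟨_, hle, le_rfl, ha.symm⟩

theorem swap_ends (H : IsGrid P Q R C pl pu ql qu) {i : I} {j : J} (hi : i ∈ R) (hj : j ∈ C) :
    ((Q j).vert (ql j i) = (P i).vert (pl i j) ∨ (Q j).vert (ql j i) = (P i).vert (pu i j)) ∧
      ((Q j).vert (qu j i) = (P i).vert (pl i j) ∨ (Q j).vert (qu j i) = (P i).vert (pu i j)) := by
  obtain ⟨d, h1, h2, h3 | h3⟩ := H.cell i hi j hj
  · have h4 := h3 0 (by omega)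
    have h5 := h3 d le_rfl
    rw [h1, h2]
    exact ⟨.inl h4.symm, .inr h5.symm⟩
  · have h4 := h3 0 (by omega)
    have h5 := h3 d le_rfl
    rw [h1, h2]
    simp only [Nat.sub_self, Nat.sub_zero, Nat.add_zero] at h4 h5
    exact ⟨.inr h5.symm, .inl h4.symm⟩

end

/-! ### From paths of the square grid to paths of the graph -/

variable {V : Type*} {G : SimpleGraph V} {P Q : ℕ → GPath G} {r c : ℕ}
  {pl pu ql qu : ℕ → ℕ → ℕ}

/-- The end of the cell `x` at which the segment towards the neighboring cell `y` starts. -/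
def att (P Q : ℕ → GPath G) (pl pu ql qu : ℕ → ℕ → ℕ) (x y : ℕ × ℕ) : V :=
  if x.1 = y.1 then
    if x.2 < y.2 then (P x.1).vert (pu x.1 x.2) else (P x.1).vert (pl x.1 x.2)
  else if x.1 < y.1 then (Q x.2).vert (qu x.2 x.1) else (Q x.2).vert (ql x.2 x.1)

theorem att_right (i j : ℕ) :
    att P Q pl pu ql qu (i, j) (i, j + 1) = (P i).vert (pu i j) := by
  simp [att]

theorem att_left (i j : ℕ) :
    att P Q pl pu ql qu (i, j + 1) (i, j) = (P i).vert (pl i (j + 1)) := by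
  simp [att]

theorem att_down (i j : ℕ) :
    att P Q pl pu ql qu (i, j) (i + 1, j) = (Q j).vert (qu j i) := by
  simp [att]

theorem att_up (i j : ℕ) :
    att P Q pl pu ql qu (i + 1, j) (i, j) = (Q j).vert (ql j (i + 1)) := by
  simp [att]

/-- The segment between neighboring cells. -/
def seg (P Q : ℕ → GPath G) (pl pu ql qu : ℕ → ℕ → ℕ) (x y : ℕ × ℕ) : Set V :=
  if x.1 = y.1 then segSet P pl pu x.1 (min x.2 y.2) (max x.2 y.2)
  else if x.2 = y.2 then segSet Q ql qu x.2 (min x.1 y.1) (max x.1 y.1) else ∅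

theorem seg_symm (x y : ℕ × ℕ) : seg P Q pl pu ql qu x y = seg P Q pl pu ql qu y x := by
  unfold seg
  by_cases h : x.1 = y.1
  · rw [if_pos h, if_pos h.symm, h, min_comm, max_comm]
  · rw [if_neg h, if_neg (Ne.symm h)]
    by_cases h' : x.2 = y.2
    · rw [if_pos h', if_pos h'.symm, h', min_comm, max_comm]
    · rw [if_neg h', if_neg (Ne.symm h')]

theorem seg_row (i j : ℕ) :
    seg P Q pl pu ql qu (i, j) (i, j + 1) = segSet P pl pu i j (j + 1) := by
  simp [seg]

theorem seg_col (i j : ℕ) :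
    seg P Q pl pu ql qu (i, j) (i + 1, j) = segSet Q ql qu j i (i + 1) := by
  simp [seg]

theorem gridGraph_cases {x y : ℕ × ℕ} (h : gridGraph.Adj x y) :
    (∃ i j, x = (i, j) ∧ y = (i, j + 1)) ∨ (∃ i j, x = (i, j + 1) ∧ y = (i, j)) ∨
      (∃ i j, x = (i, j) ∧ y = (i + 1, j)) ∨ ∃ i j, x = (i + 1, j) ∧ y = (i, j) := by
  obtain ⟨i, j⟩ := x
  obtain ⟨i', j'⟩ := y
  rcases h with ⟨h1, h2⟩ | ⟨h1, h2⟩ <;> simp only at h1 h2 <;> subst h1 <;>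
    rcases h2 with rfl | rfl <;> simp

theorem exists_seg_path (H : IsGrid P Q (Finset.range r) (Finset.range c) pl pu ql qu)
    {x y : ℕ × ℕ} (hx : x.1 < r ∧ x.2 < c) (hy : y.1 < r ∧ y.2 < c) (h : gridGraph.Adj x y) :
    ∃ g : G.Walk (att P Q pl pu ql qu x y) (att P Q pl pu ql qu y x), g.IsPath ∧
      ∀ v, v ∈ g.support ↔ v ∈ seg P Q pl pu ql qu x y := by
  have hrow : ∀ i j, i < r → j + 1 < c →
      ∃ g : G.Walk (att P Q pl pu ql qu (i, j) (i, j + 1)) (att P Q pl pu ql qu (i, j + 1) (i, j)),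
      g.IsPath ∧ ∀ v, v ∈ g.support ↔ v ∈ seg P Q pl pu ql qu (i, j) (i, j + 1) := by
    intro i j hi hj
    rw [seg_row, att_right, att_left]
    exact H.exists_seg (Finset.mem_range.2 hi) (Finset.mem_range.2 (by omega))
      (Finset.mem_range.2 hj) (Nat.lt_succ_self j)
  have hcol : ∀ i j, i + 1 < r → j < c →
      ∃ g : G.Walk (att P Q pl pu ql qu (i, j) (i + 1, j)) (att P Q pl pu ql qu (i + 1, j) (i, j)),
      g.IsPath ∧ ∀ v, v ∈ g.support ↔ v ∈ seg P Q pl pu ql qu (i, j) (i + 1, j) := by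
    intro i j hi hj
    rw [seg_col, att_down, att_up]
    exact H.swap.exists_seg (Finset.mem_range.2 hj) (Finset.mem_range.2 (by omega))
      (Finset.mem_range.2 hi) (Nat.lt_succ_self i)
  rcases gridGraph_cases h with ⟨i, j, rfl, rfl⟩ | ⟨i, j, rfl, rfl⟩ | ⟨i, j, rfl, rfl⟩ |
    ⟨i, j, rfl, rfl⟩
  · exact hrow i j hx.1 hy.2
  · obtain ⟨g, hg, hs⟩ := hrow i j hx.1 hx.2
    exact ⟨g.reverse, hg.reverse, fun v => by rw [seg_symm, ← hs]; simp⟩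
  · exact hcol i j hy.1 hx.2
  · obtain ⟨g, hg, hs⟩ := hcol i j hx.1 hx.2
    exact ⟨g.reverse, hg.reverse, fun v => by rw [seg_symm, ← hs]; simp⟩

theorem att_eq (H : IsGrid P Q (Finset.range r) (Finset.range c) pl pu ql qu) {x y : ℕ × ℕ}
    (hx : x.1 < r ∧ x.2 < c) :
    att P Q pl pu ql qu x y = (P x.1).vert (pl x.1 x.2) ∨
      att P Q pl pu ql qu x y = (P x.1).vert (pu x.1 x.2) := by
  have := H.swap_ends (Finset.mem_range.2 hx.1) (Finset.mem_range.2 hx.2)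
  unfold att
  split_ifs
  · exact .inr rfl
  · exact .inl rfl
  · exact this.2
  · exact this.1

theorem seg_inter_cellSet (H : IsGrid P Q (Finset.range r) (Finset.range c) pl pu ql qu)
    {x y z : ℕ × ℕ} (hx : x.1 < r ∧ x.2 < c) (hy : y.1 < r ∧ y.2 < c) (hz : z.1 < r ∧ z.2 < c)
    (h : gridGraph.Adj x y) {v : V} (hv : v ∈ seg P Q pl pu ql qu x y)
    (hv' : v ∈ cellSet P pl pu z.1 z.2) :
    (z = x ∧ v = att P Q pl pu ql qu x y) ∨ (z = y ∧ v = att P Q pl pu ql qu y x) := by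
  obtain ⟨a, b⟩ := z
  have hrow : ∀ i j, i < r → j + 1 < c → v ∈ seg P Q pl pu ql qu (i, j) (i, j + 1) →
      ((a, b) = (i, j) ∧ v = att P Q pl pu ql qu (i, j) (i, j + 1)) ∨
        ((a, b) = (i, j + 1) ∧ v = att P Q pl pu ql qu (i, j + 1) (i, j)) := by
    intro i j hi hj hv
    rw [seg_row] at hv
    simpa [att_right, att_left, and_assoc, and_or_left] using
      H.segSet_inter_cellSet (Finset.mem_range.2 hi) (Finset.mem_range.2 hz.1)
      (Finset.mem_range.2 (by omega)) (Finset.mem_range.2 hj) (Finset.mem_range.2 hz.2)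
      (by omega) hv hv'
  have hcol : ∀ i j, i + 1 < r → j < c → v ∈ seg P Q pl pu ql qu (i, j) (i + 1, j) →
      ((a, b) = (i, j) ∧ v = att P Q pl pu ql qu (i, j) (i + 1, j)) ∨
        ((a, b) = (i + 1, j) ∧ v = att P Q pl pu ql qu (i + 1, j) (i, j)) := by
    intro i j hi hj hv
    rw [seg_col] at hv
    rw [H.cellSet_swap (Finset.mem_range.2 hz.1) (Finset.mem_range.2 hz.2)] at hv'
    have := H.swap.segSet_inter_cellSet (Finset.mem_range.2 hj) (Finset.mem_range.2 hz.2)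
      (Finset.mem_range.2 (by omega)) (Finset.mem_range.2 hi) (Finset.mem_range.2 hz.1)
      (by omega) hv hv'
    simp only [att_down, att_up, Prod.mk.injEq]
    tauto
  rcases gridGraph_cases h with ⟨i, j, rfl, rfl⟩ | ⟨i, j, rfl, rfl⟩ | ⟨i, j, rfl, rfl⟩ |
    ⟨i, j, rfl, rfl⟩
  · exact hrow i j hx.1 hy.2 hv
  · rw [seg_symm] at hv
    exact (hrow i j hx.1 hx.2 hv).symm
  · exact hcol i j hy.1 hx.2 hv
  · rw [seg_symm] at hv
    exact (hcol i j hx.1 hx.2 hv).symm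

theorem seg_cases {x y : ℕ × ℕ} (hx : x.1 < r ∧ x.2 < c) (hy : y.1 < r ∧ y.2 < c)
    (h : gridGraph.Adj x y) :
    (∃ i j, i < r ∧ j + 1 < c ∧ s(x, y) = s((i, j), (i, j + 1)) ∧
      seg P Q pl pu ql qu x y = segSet P pl pu i j (j + 1)) ∨
    ∃ i j, i + 1 < r ∧ j < c ∧ s(x, y) = s((i, j), (i + 1, j)) ∧
      seg P Q pl pu ql qu x y = segSet Q ql qu j i (i + 1) := by
  rcases gridGraph_cases h with ⟨i, j, rfl, rfl⟩ | ⟨i, j, rfl, rfl⟩ | ⟨i, j, rfl, rfl⟩ |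
    ⟨i, j, rfl, rfl⟩
  · exact .inl ⟨i, j, hx.1, hy.2, rfl, seg_row i j⟩
  · exact .inl ⟨i, j, hx.1, hx.2, Sym2.eq_swap, by rw [seg_symm, seg_row]⟩
  · exact .inr ⟨i, j, hy.1, hx.2, rfl, seg_col i j⟩
  · exact .inr ⟨i, j, hx.1, hx.2, Sym2.eq_swap, by rw [seg_symm, seg_col]⟩

theorem seg_inter_seg (H : IsGrid P Q (Finset.range r) (Finset.range c) pl pu ql qu)
    {x y x' y' : ℕ × ℕ} (hx : x.1 < r ∧ x.2 < c) (hy : y.1 < r ∧ y.2 < c)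
    (h : gridGraph.Adj x y) (hx' : x'.1 < r ∧ x'.2 < c) (hy' : y'.1 < r ∧ y'.2 < c)
    (h' : gridGraph.Adj x' y') {v : V} (hv : v ∈ seg P Q pl pu ql qu x y)
    (hv' : v ∈ seg P Q pl pu ql qu x' y') :
    s(x, y) = s(x', y') ∨ ∃ z : ℕ × ℕ, (z.1 < r ∧ z.2 < c) ∧ v ∈ cellSet P pl pu z.1 z.2 := by
  rcases seg_cases (P := P) (Q := Q) (pl := pl) (pu := pu) (ql := ql) (qu := qu) hx hy h with
    ⟨i, j, hi, hj, e, e₁⟩ | ⟨i, j, hi, hj, e, e₁⟩ <;>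
  rcases seg_cases (P := P) (Q := Q) (pl := pl) (pu := pu) (ql := ql) (qu := qu) hx' hy' h' with
    ⟨i', j', hi', hj', e', e₁'⟩ | ⟨i', j', hi', hj', e', e₁'⟩ <;>
  rw [e₁] at hv <;> rw [e₁'] at hv' <;> rw [e, e'] <;>
  have aux : ∀ {a b : ℕ}, a + 1 < b → a ∈ Finset.range b := fun h => by simp; omega
  · have hi0 := Finset.mem_range.2 hi
    have hi0' := Finset.mem_range.2 hi'
    have hj0 := Finset.mem_range.2 hj
    have hj0' := Finset.mem_range.2 hj'
    rcases lt_trichotomy j j' with hjj | rfl | hjj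
    · exact .inr ⟨(i, j + 1), ⟨hi, hj⟩,
        H.segSet_inter_segSet hi0 hi0' hj0 (aux hj') hj0' hjj hv hv'⟩
    · left
      obtain ⟨t, h1, h2, rfl⟩ := hv
      obtain ⟨t', h3, h4, e⟩ := hv'
      rw [(H.eq_of_vert_eq hi0 hi0' ((h2.trans (H.pl_le hi0 hj0)).trans (H.pu_le i hi0 _ hj0))
        ((h4.trans (H.pl_le hi0' hj0)).trans (H.pu_le i' hi0' _ hj0)) e.symm).1]
    · exact .inr ⟨(i', j' + 1), ⟨hi', hj'⟩,
        H.segSet_inter_segSet hi0' hi0 hj0' (aux hj) hj0 hjj hv' hv⟩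
  · exact .inr ⟨(i, j'), ⟨hi, hj'⟩, H.segSet_inter_segSet_swap (Finset.mem_range.2 hi) (aux hi')
      (Finset.mem_range.2 hi') (Finset.mem_range.2 hj') (aux hj) (Finset.mem_range.2 hj) hv hv'⟩
  · exact .inr ⟨(i', j), ⟨hi', hj⟩, H.segSet_inter_segSet_swap (Finset.mem_range.2 hi') (aux hi)
      (Finset.mem_range.2 hi) (Finset.mem_range.2 hj) (aux hj') (Finset.mem_range.2 hj') hv' hv⟩
  · have hi0 := Finset.mem_range.2 hi
    have hi0' := Finset.mem_range.2 hi'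
    have hj0 := Finset.mem_range.2 hj
    have hj0' := Finset.mem_range.2 hj'
    rcases lt_trichotomy i i' with hii | rfl | hii
    · refine .inr ⟨(i + 1, j), ⟨hi, hj⟩, ?_⟩
      rw [H.cellSet_swap hi0 hj0]
      exact H.swap.segSet_inter_segSet hj0 hj0' hi0 (aux hi') hi0' hii hv hv'
    · left
      obtain ⟨t, h1, h2, rfl⟩ := hv
      obtain ⟨t', h3, h4, e⟩ := hv'
      rw [(H.swap.eq_of_vert_eq hj0 hj0' ((h2.trans (H.swap.pl_le hj0 hi0)).trans
        (H.qu_le j hj0 _ hi0))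
        ((h4.trans (H.swap.pl_le hj0' hi0)).trans (H.qu_le j' hj0' _ hi0)) e.symm).1]
    · refine .inr ⟨(i' + 1, j'), ⟨hi', hj'⟩, ?_⟩
      rw [H.cellSet_swap hi0' hj0']
      exact H.swap.segSet_inter_segSet hj0' hj0 hi0' (aux hi) hi0 hii hv' hv

/-- A path of the square grid yields a path of `G` along the corresponding rows and columns. -/
theorem exists_path (H : IsGrid P Q (Finset.range r) (Finset.range c) pl pu ql qu)
    {a b : ℕ × ℕ} {U : Set (ℕ × ℕ)} {E : Set (Sym2 (ℕ × ℕ))} (hE : E.Nonempty)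
    (hU : ∀ x ∈ U, x.1 < r ∧ x.2 < c) (hp : PathIn gridGraph a b U E) :
    ∃ p : GPath G,
      (∀ v ∈ p.verts,
        (∃ i < r, ∃ t, pl i 0 ≤ t ∧ t ≤ pu i (c - 1) ∧ (P i).vert t = v) ∨
        ∃ j < c, ∃ s, ql j 0 ≤ s ∧ s ≤ qu j (r - 1) ∧ (Q j).vert s = v) ∧
      (∀ i j, s((i, j), (i, j + 1)) ∈ E → segSet P pl pu i j (j + 1) ⊆ p.verts) ∧
      (∀ i j, s((i, j), (i + 1, j)) ∈ E → segSet Q ql qu j i (i + 1) ⊆ p.verts) ∧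
      (∀ i j, s((i, j), (i, j + 1)) ∈ E → s((i, j + 1), (i, j + 2)) ∈ E →
        cellSet P pl pu i (j + 1) ⊆ p.verts) := by
  obtain ⟨w, hw, hwU, hwE⟩ := hp
  cases w with
  | nil =>
    -- The lift needs a first edge, which exists because the path uses the edges of the nonempty set
    -- `E`.
    obtain ⟨e, he⟩ := hE
    simpa using hwE e he
  | @cons _ y _ hay w =>
    rw [Walk.cons_isPath_iff] at hw
    have hB : ∀ u ∈ w.support, u.1 < r ∧ u.2 < c := fun u hu => hU u (hwU u (by simp [hu]))
    have haB : a.1 < r ∧ a.2 < c := hU a (hwU a (by simp))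
    have hyB := hB y (by simp)
    obtain ⟨b, g, hg, h1, h2, h3⟩ := exists_lift (G := G) (Γ := gridGraph)
      {x | x.1 < r ∧ x.2 < c} (att P Q pl pu ql qu) (seg P Q pl pu ql qu)
      (fun x => cellSet P pl pu x.1 x.2) (fun x y z => x.1 = y.1 ∧ y.1 = z.1)
      seg_symm (fun x y z h => ⟨h.2.symm, h.1.symm⟩)
      (fun x hx y hy h => H.exists_seg_path hx hy h)
      (fun x hx y hy z hz hxy hyz hne => by
        obtain ⟨g, hg, hU, hs⟩ := H.exists_corner (Finset.mem_range.2 hy.1)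
          (Finset.mem_range.2 hy.2) (H.att_eq (y := x) hy) (H.att_eq (y := z) hy)
        refine ⟨g, hg, hU, fun hstr => hs ?_⟩
        obtain ⟨x₁, x₂⟩ := x
        obtain ⟨y₁, y₂⟩ := y
        obtain ⟨z₁, z₂⟩ := z
        obtain ⟨h1, h2⟩ := hstr
        simp only at h1 h2
        subst h1 h2
        rw [gridGraph_adj] at hxy hyz
        simp only at hxy hyz
        -- Different neighbors of `y` in its row lie on opposite sides of it, hence attach to
        -- opposite ends of its cell.
        have hne' : x₂ ≠ z₂ := fun h => hne (by rw [h])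
        simp only [att, if_true]
        rcases Nat.lt_or_ge y₂ x₂ with h | h
        · rw [if_pos h, if_neg (by omega)]
          exact .inr ⟨rfl, rfl⟩
        · rw [if_neg (by omega), if_pos (by omega)]
          exact .inl ⟨rfl, rfl⟩)
      (fun x hx y hy v hv hv' => by
        obtain ⟨h1, h2⟩ := H.cellSet_inj (Finset.mem_range.2 hx.1) (Finset.mem_range.2 hy.1)
          (Finset.mem_range.2 hx.2) (Finset.mem_range.2 hy.2) hv hv'
        exact Prod.ext h1 h2)
      (fun x hx y hy h z hz v hv hv' => H.seg_inter_cellSet hx hy hz h hv hv')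
      (fun x hx y hy h x' hx' y' hy' h' v hv hv' => H.seg_inter_seg hx hy h hx' hy' h' hv hv')
      w hw.1 hB a haB hay hw.2
    have hpos : ∀ {i j}, i < r → j < c → ∀ {t}, pl i j ≤ t → pl i 0 ≤ t := fun hi hj t ht =>
      (H.pl_mono (Finset.mem_range.2 hi) (Finset.mem_range.2 (by omega)) (Finset.mem_range.2 hj)
        (Nat.zero_le _)).trans ht
    have hpos' : ∀ {i j}, i < r → j < c → ∀ {t}, t ≤ pu i j → t ≤ pu i (c - 1) :=
      fun hi hj t ht => ht.trans
      (H.pu_mono (Finset.mem_range.2 hi) (Finset.mem_range.2 hj) (Finset.mem_range.2 (by omega))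
        (by omega))
    have hqos : ∀ {i j}, i < r → j < c → ∀ {t}, ql j i ≤ t → ql j 0 ≤ t := fun hi hj t ht =>
      (H.swap.pl_mono (Finset.mem_range.2 hj) (Finset.mem_range.2 (by omega))
        (Finset.mem_range.2 hi) (Nat.zero_le _)).trans ht
    have hqos' : ∀ {i j}, i < r → j < c → ∀ {t}, t ≤ qu j i → t ≤ qu j (r - 1) :=
      fun hi hj t ht => ht.trans
      (H.swap.pu_mono (Finset.mem_range.2 hj) (Finset.mem_range.2 hi)
        (Finset.mem_range.2 (by omega)) (by omega))
    refine ⟨⟨_, b, g, hg⟩, fun v hv => ?_, fun i j h v hv => ?_, fun i j h v hv => ?_,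
      fun i j h h' v hv => ?_⟩
    · rcases h1 v hv with ⟨u, u', hu, hvu⟩ | ⟨u, hu, t, ht, ht', hvt⟩
      · have hu' : u ∈ (Walk.cons hay w).support ∧ u' ∈ (Walk.cons hay w).support ∧
            gridGraph.Adj u u' := by
          rw [← Walk.edges_cons hay w] at hu
          exact ⟨Walk.fst_mem_support_of_mem_edges _ hu, Walk.snd_mem_support_of_mem_edges _ hu,
            Walk.adj_of_mem_edges _ hu⟩
        rcases seg_cases (P := P) (Q := Q) (pl := pl) (pu := pu) (ql := ql) (qu := qu)
          (hU u (hwU u hu'.1)) (hU u' (hwU u' hu'.2.1)) hu'.2.2 with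
          ⟨i, j, hi, hj, e, e'⟩ | ⟨i, j, hi, hj, e, e'⟩ <;> rw [e'] at hvu <;>
          obtain ⟨t, ht, ht', hvt⟩ := hvu
        · have ha := H.pl_le (Finset.mem_range.2 hi) (Finset.mem_range.2 (by omega : j < c))
          have hb := H.pl_le (Finset.mem_range.2 hi) (Finset.mem_range.2 hj)
          exact .inl ⟨i, hi, t, hpos hi (by omega : j < c) (by omega),
            hpos' hi hj (by omega), hvt⟩
        · have ha := H.swap.pl_le (Finset.mem_range.2 hj) (Finset.mem_range.2 (by omega : i < r))
          have hb := H.swap.pl_le (Finset.mem_range.2 hj) (Finset.mem_range.2 hi)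
          exact .inr ⟨j, hj, t, hqos (by omega : i < r) hj (by omega),
            hqos' hi hj (by omega), hvt⟩
      · have := hB u hu
        exact .inl ⟨u.1, this.1, t, hpos this.1 this.2 ht, hpos' this.1 this.2 ht', hvt⟩
    · refine h2 (i, j) (i, j + 1) ?_ v (by rwa [seg_row])
      simpa using hwE _ h
    · refine h2 (i, j) (i + 1, j) ?_ v (by rwa [seg_col])
      simpa using hwE _ h
    · refine h3 (i, j) (i, j + 1) (i, j + 2) ?_ ?_ (by simp) ⟨rfl, rfl⟩ v hv
      · simpa using hwE _ h
      · simpa using hwE _ h'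

end IsGrid

/-! ### Frequent colors and spread-out choices -/

/-- Greedy choice of representatives that avoid `B` and have pairwise distance more than `d`. -/
theorem exists_spread {ι : Type*} [Fintype ι] (s : ι → Finset ℕ) (B : Finset ℕ) (d : ℕ)
    (h : ∀ x, B.card + (2 * d + 1) * Fintype.card ι ≤ (s x).card) :
    ∃ f : ι → ℕ, ∀ x, f x ∈ s x ∧ f x ∉ B ∧ ∀ y, x ≠ y → f x + d < f y ∨ f y + d < f x := by
  classical
  suffices h : ∀ T : Finset ι, ∃ f : ι → ℕ, ∀ x ∈ T, f x ∈ s x ∧ f x ∉ B ∧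
      ∀ y ∈ T, x ≠ y → f x + d < f y ∨ f y + d < f x by
    obtain ⟨f, hf⟩ := h Finset.univ
    exact ⟨f, fun x => by simpa using hf x⟩
  intro T
  induction T using Finset.induction_on with
  | empty => exact ⟨fun _ => 0, by simp⟩
  | insert a T ha ih =>
    obtain ⟨f, hf⟩ := ih
    -- The forbidden values: every earlier choice blocks at most `2 * d + 1` of them.
    set D := B ∪ T.biUnion fun x => Finset.Icc (f x - d) (f x + d)
    have hT : T.card < Fintype.card ι := Finset.card_lt_univ_of_notMem ha
    have hD : D.card < (s a).card := by
      calc D.card ≤ B.card + (T.biUnion fun x => Finset.Icc (f x - d) (f x + d)).card :=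
            Finset.card_union_le _ _
        _ ≤ B.card + T.card * (2 * d + 1) := by
            gcongr
            refine Finset.card_biUnion_le_card_mul _ _ _ fun x _ => ?_
            rw [Nat.card_Icc]
            omega
        _ < B.card + (2 * d + 1) * Fintype.card ι := by
            rw [mul_comm]
            gcongr
        _ ≤ (s a).card := h a
    obtain ⟨v, hv, hvD⟩ := Finset.exists_mem_notMem_of_card_lt_card hD
    simp only [D, Finset.mem_union, Finset.mem_biUnion, Finset.mem_Icc, not_or, not_exists,
      not_and] at hvD
    have hva : ∀ x ∈ T, f x + d < v ∨ v + d < f x := fun x hx => by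
      have := hvD.2 x hx
      omega
    refine ⟨Function.update f a v, fun x hx => ?_⟩
    by_cases hxa : x = a
    · subst hxa
      rw [Function.update_self]
      refine ⟨hv, hvD.1, fun y hy hne => ?_⟩
      rw [Function.update_of_ne hne.symm]
      exact (hva y ((Finset.mem_insert.1 hy).resolve_left hne.symm)).symm
    · have hxT := (Finset.mem_insert.1 hx).resolve_left hxa
      rw [Function.update_of_ne hxa]
      refine ⟨(hf x hxT).1, (hf x hxT).2.1, fun y hy hne => ?_⟩
      by_cases hya : y = a
      · subst hya
        rw [Function.update_self]
        exact hva x hxT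
      · rw [Function.update_of_ne hya]
        exact (hf x hxT).2.2 y ((Finset.mem_insert.1 hy).resolve_left hya) hne

/-- A finite set without its least and its greatest element. -/
def interior {J : Type*} [LinearOrder J] (C : Finset J) : Finset J :=
  C.filter fun j => (∃ a ∈ C, a < j) ∧ ∃ b ∈ C, j < b

theorem card_le_card_interior {J : Type*} [LinearOrder J] (C : Finset J) :
    C.card ≤ (interior C).card + 2 := by
  rcases C.eq_empty_or_nonempty with rfl | hC
  · simp
  · have : C ⊆ interior C ∪ {C.min' hC, C.max' hC} := by
      intro j hj
      simp only [interior, Finset.mem_union, Finset.mem_filter, Finset.mem_insert,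
        Finset.mem_singleton]
      rcases (C.min'_le j hj).eq_or_lt with h | h
      · exact .inr (.inl h.symm)
      · rcases (C.le_max' j hj).eq_or_lt with h' | h'
        · exact .inr (.inr h')
        · exact .inl ⟨hj, ⟨_, C.min'_mem hC, h⟩, ⟨_, C.max'_mem hC, h'⟩⟩
    exact (Finset.card_le_card this).trans ((Finset.card_union_le _ _).trans
      (Nat.add_le_add_left Finset.card_le_two _))

/-- By deleting few rows and columns, all colors that are left become frequent. -/
theorem exists_robust {I J α : Type*} [LinearOrder J] (tP tQ : ℕ)
    (oP : I → Finset J → Set α) (oQ : J → Finset I → Set α)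
    (hP : ∀ i C C', C ⊆ C' → oP i C ⊆ oP i C') (hQ : ∀ j R R', R ⊆ R' → oQ j R ⊆ oQ j R')
    (A B : Finset α) (R : Finset I) (C : Finset J) (hA : ∀ i ∈ R, oP i C ⊆ A)
    (hB : ∀ j ∈ C, oQ j R ⊆ B) :
    ∃ R' ⊆ R, ∃ C' ⊆ C, R.card ≤ R'.card + A.card * tP ∧
      C.card ≤ C'.card + B.card * tQ + 2 * A.card ∧
      (∀ i ∈ R', ∀ a ∈ oP i C', ∃ S ⊆ R', tP ≤ S.card ∧ ∀ i' ∈ S, a ∈ oP i' (interior C')) ∧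
      ∀ j ∈ C', ∀ a ∈ oQ j R', ∃ S ⊆ C', tQ ≤ S.card ∧ ∀ j' ∈ S, a ∈ oQ j' R' := by
  classical
  -- Each round eliminates one color. A row color seen between the inner columns on fewer than `tP`
  -- rows disappears with these rows and the two extreme columns; a column color seen on fewer than
  -- `tQ` columns disappears with these. By monotonicity, eliminated colors never come back.
  obtain ⟨n, hn⟩ : ∃ n, A.card + B.card = n := ⟨_, rfl⟩
  induction n generalizing A B R C with
  | zero =>
    have hA0 : A = ∅ := by rw [← Finset.card_eq_zero]; omega
    have hB0 : B = ∅ := by rw [← Finset.card_eq_zero]; omega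
    refine ⟨R, subset_rfl, C, subset_rfl, by omega, by omega, fun i hi a ha => ?_,
      fun j hj a ha => ?_⟩
    · simpa [hA0] using hA i hi ha
    · simpa [hB0] using hB j hj ha
  | succ n ih =>
    by_cases h1 : ∀ i ∈ R, ∀ a ∈ oP i C,
        ∃ S ⊆ R, tP ≤ S.card ∧ ∀ i' ∈ S, a ∈ oP i' (interior C)
    · by_cases h2 : ∀ j ∈ C, ∀ a ∈ oQ j R, ∃ S ⊆ C, tQ ≤ S.card ∧ ∀ j' ∈ S, a ∈ oQ j' R
      · exact ⟨R, subset_rfl, C, subset_rfl, by omega, by omega, h1, h2⟩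
      · push Not at h2
        obtain ⟨j, hj, a, ha, h2⟩ := h2
        have haB : a ∈ B := hB j hj ha
        set S := C.filter fun j => a ∈ oQ j R
        have hS : S.card < tQ := by
          by_contra hS
          obtain ⟨j', hj', h3⟩ := h2 S (Finset.filter_subset _ _) (not_lt.1 hS)
          exact h3 (Finset.mem_filter.1 hj').2
        have hBc := Finset.card_erase_add_one haB
        obtain ⟨R', hR', C', hC', h3, h4, h5⟩ := ih A (B.erase a) R (C \ S)
          (fun i hi => (hP i _ _ Finset.sdiff_subset).trans (hA i hi))
          (fun j hj b hb => by
            rw [Finset.mem_sdiff] at hj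
            rw [Finset.mem_coe, Finset.mem_erase]
            refine ⟨?_, hB j hj.1 hb⟩
            rintro rfl
            exact hj.2 (Finset.mem_filter.2 ⟨hj.1, hb⟩))
          (by omega)
        refine ⟨R', hR', C', hC'.trans Finset.sdiff_subset, h3, ?_, h5⟩
        have : (C \ S).card + S.card = C.card :=
          Finset.card_sdiff_add_card_eq_card (Finset.filter_subset _ _)
        rw [← hBc, add_mul]
        omega
    · push Not at h1
      obtain ⟨i, hi, a, ha, h1⟩ := h1
      have haA : a ∈ A := hA i hi ha
      set S := R.filter fun i => a ∈ oP i (interior C)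
      have hS : S.card < tP := by
        by_contra hS
        obtain ⟨i', hi', h3⟩ := h1 S (Finset.filter_subset _ _) (not_lt.1 hS)
        exact h3 (Finset.mem_filter.1 hi').2
      have hAc := Finset.card_erase_add_one haA
      have hint : interior C ⊆ C := Finset.filter_subset _ _
      obtain ⟨R', hR', C', hC', h3, h4, h5⟩ := ih (A.erase a) B (R \ S) (interior C)
        (fun i hi b hb => by
          rw [Finset.mem_sdiff] at hi
          rw [Finset.mem_coe, Finset.mem_erase]
          refine ⟨?_, hA i hi.1 (hP i _ _ hint hb)⟩
          rintro rfl
          exact hi.2 (Finset.mem_filter.2 ⟨hi.1, hb⟩))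
        (fun j hj => (hQ j _ _ Finset.sdiff_subset).trans (hB j (hint hj)))
        (by omega)
      refine ⟨R', hR'.trans Finset.sdiff_subset, C', hC'.trans hint, ?_, ?_, h5⟩
      · have : (R \ S).card + S.card = R.card :=
          Finset.card_sdiff_add_card_eq_card (Finset.filter_subset _ _)
        rw [← hAc, add_mul]
        omega
      · have := card_le_card_interior C
        omega

/-- The increasing enumeration of a nonempty finite set. -/
theorem exists_enumeration {I : Type*} [LinearOrder I] {R : Finset I} (hR : R.Nonempty) :
    ∃ ρ : ℕ → I, (∀ n < R.card, ρ n ∈ R) ∧ (∀ m n, m < n → n < R.card → ρ m < ρ n) ∧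
      ∀ i ∈ R, ∃ n < R.card, ρ n = i := by
  refine ⟨fun n => if h : n < R.card then R.orderEmbOfFin rfl ⟨n, h⟩ else R.min' hR,
    fun n hn => ?_, fun m n hmn hn => ?_, fun i hi => ?_⟩
  · simp only [hn, dif_pos]
    exact R.orderEmbOfFin_mem rfl _
  · simp only [hn, hmn.trans hn, dif_pos]
    exact (R.orderEmbOfFin rfl).strictMono hmn
  · have : i ∈ Set.range (R.orderEmbOfFin rfl) := by simpa using hi
    obtain ⟨⟨n, hn⟩, e⟩ := this
    exact ⟨n, hn, by simp only [hn, dif_pos]; exact e⟩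

theorem exists_interval (f : ℕ → ℕ) {a b s : ℕ} (hab : a ≤ b) (ha : f a ≤ s) (hb : s < f b) :
    ∃ l, a ≤ l ∧ l < b ∧ f l ≤ s ∧ s < f (l + 1) := by
  induction b, hab using Nat.le_induction with
  | base => omega
  | succ b hab ih =>
    rcases Nat.lt_or_ge s (f b) with h | h
    · obtain ⟨l, h1, h2, h3⟩ := ih h
      exact ⟨l, h1, by omega, h3⟩
    · exact ⟨b, hab, by omega, h, hb⟩

/-! ### A grid path through prescribed positions -/

/-- A path of the grid with `r` rows and `c` columns through the given row positions
`(i z, l z)` and column positions `(g w, j w)`: it uses the two edges of row `i z` at the column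
`l z`, and the edge of column `j w` below row `g w`. -/
theorem exists_grid_path {r c : ℕ} (hr : 2 ≤ r) {ι κ : Type*} [Fintype κ]
    (i l : ι → ℕ) (g j : κ → ℕ)
    (hi : ∀ z, 2 ≤ i z ∧ i z + 3 ≤ r) (hii : ∀ z z', z ≠ z' → i z + 2 < i z' ∨ i z' + 2 < i z)
    (hl : ∀ z, 1 ≤ l z ∧ l z + 1 < c) (hg : ∀ w, g w + 1 < r) (hj : ∀ w, j w < c)
    (hjj : Function.Injective j) (hjl : ∀ w z, j w ≠ l z ∧ j w ≠ l z + 1) (hc : 0 < c) :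
    ∃ a b : ℕ × ℕ, ∃ U E, E.Nonempty ∧ (∀ x ∈ U, x.1 < r ∧ x.2 < c) ∧
      PathIn gridGraph a b U E ∧
      (∀ z, s((i z, l z), (i z, l z + 1)) ∈ E ∧ s((i z, l z - 1), (i z, l z)) ∈ E) ∧
      ∀ w, s((g w, j w), (g w + 1, j w)) ∈ E := by
  classical
  -- In column `j w` the edge below row `gx (j w)` must survive. On other columns nothing is
  -- prescribed and the default value is harmless.
  set gx : ℕ → ℕ := Function.extend j g 0
  have hgx : ∀ w, gx (j w) = g w := hjj.extend_apply g 0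
  set X : Finset ℕ := insert 0 (Finset.univ.image j)
  have hX : ∀ x ∈ X, x = 0 ∨ ∃ w, j w = x := by simp [X]
  -- The position `(i z, l z)` is covered by a detour from the last column of `X` not after `l z`. A
  -- detour at `f` covers the rows `f` and `f + 1` but removes the column edge between them; so it
  -- is moved up by one row if it would remove the prescribed edge.
  set F : ℕ → Set ℕ := fun x => {f | ∃ z, x ≤ l z ∧ (∀ x' ∈ X, x < x' → l z < x') ∧
    f = if i z = gx x then i z - 1 else i z}
  -- Since `X` avoids `l z` and `l z + 1`, the detour extends far enough to contain both row edges
  -- at column `l z`.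
  have hXl : ∀ x ∈ X, ∀ z, x ≤ l z → x < l z := by
    intro x hx z hxz
    have h1 := hl z
    rcases hX x hx with rfl | ⟨w, rfl⟩
    · omega
    · have := hjl w z
      omega
  have hXl' : ∀ x ∈ X, ∀ z, l z < x → l z + 1 < x := by
    intro x hx z hxz
    have h1 := hl z
    rcases hX x hx with rfl | ⟨w, rfl⟩
    · omega
    · have := hjl w z
      omega
  have hgF : ∀ x, gx x ∉ F x := by
    rintro x ⟨z, -, -, h⟩
    have := hi z
    split_ifs at h <;> omega
  obtain ⟨m, hm, e, he, hp⟩ := pathIn_snake (h := r - 1) (F := F) X c (by simp [X])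
    (fun x hx => by
      rcases hX x hx with rfl | ⟨w, rfl⟩
      · exact hc
      · exact hj w)
    (fun x hx f hf => by
      obtain ⟨z, h1, h2, h3⟩ := hf
      have h4 := hXl x hx z h1
      have h5 := hl z
      have h6 := hi z
      have hf1 : f = i z ∨ f + 1 = i z := by split_ifs at h3 <;> omega
      refine ⟨by omega, fun x' hx' hxx' => by have := h2 x' hx' hxx'; omega, by omega,
        by omega, ?_⟩
      rintro ⟨z', h1', h2', h3'⟩
      by_cases hzz : z = z'
      · subst hzz
        omega
      -- The rows differ by at least three and a detour moves by at most one row, so different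
      -- detours cannot be adjacent.
      · have := hii z z' hzz
        split_ifs at h3' <;> omega)
  refine ⟨_, _, _, _, ?_, fun x hx => ⟨by have := hx.1; omega, hx.2.1⟩, hp, fun z => ?_,
    fun w => ?_⟩
  · refine ⟨_, .inl ⟨0, by simp [X], 0, by omega, ?_, rfl⟩⟩
    rintro ⟨z, h1, h2, h3⟩
    have := hi z
    split_ifs at h3 <;> omega
  · have hne : (X.filter (· ≤ l z)).Nonempty := ⟨0, by simp [X]⟩
    obtain ⟨hx, hxl⟩ := Finset.mem_filter.1 ((X.filter (· ≤ l z)).max'_mem hne)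
    have hmax : ∀ x' ∈ X, (X.filter (· ≤ l z)).max' hne < x' → l z < x' := by
      intro x' hx' h
      by_contra h'
      exact absurd ((X.filter (· ≤ l z)).le_max' x' (Finset.mem_filter.2 ⟨hx', not_lt.1 h'⟩))
        (not_le.2 h)
    generalize (X.filter (· ≤ l z)).max' hne = x at hx hxl hmax
    have h1 := hXl x hx z hxl
    have h2 := hl z
    have hif : ∀ f, f = (if i z = gx x then i z - 1 else i z) → i z = f ∨ i z = f + 1 := by
      intro f hf
      have := hi z
      split_ifs at hf <;> omega
    refine ⟨.inr ⟨x, hx, _, ⟨z, hxl, hmax, rfl⟩, i z, l z, hif _ rfl, hxl, h2.2,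
      fun x' hx' h => hXl' x' hx' z (hmax x' hx' h), rfl⟩, .inr ⟨x, hx, _,
      ⟨z, hxl, hmax, rfl⟩, i z, l z - 1, hif _ rfl, by omega, by omega,
      fun x' hx' h => ?_, by rw [Nat.sub_add_cancel h2.1]⟩⟩
    have := hmax x' hx' h
    omega
  · refine .inl ⟨j w, by simp [X], g w, by have := hg w; omega, ?_, rfl⟩
    rw [← hgx w]
    exact hgF _

/-! ### Frequent colors rule out a center -/

/-- If every color of the rows and columns of a grid is frequent, then the coloring is not
linear. -/
theorem IsGrid.not_isLinearColoring_of_range {V α : Type*} {G : SimpleGraph V} {P Q : ℕ → GPath G}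
    {r c : ℕ} {pl pu ql qu : ℕ → ℕ → ℕ}
    (H : IsGrid P Q (Finset.range r) (Finset.range c) pl pu ql qu) (hr : 2 ≤ r) (hc : 0 < c)
    (ψ : V → α) (A B : Finset α)
    (hP : ∀ i < r, ∀ t, pl i 0 ≤ t → t ≤ pu i (c - 1) → ψ ((P i).vert t) ∈ A ∧
      ∃ S : Finset ℕ, 10 * A.card + 4 ≤ S.card ∧ ∀ i' ∈ S, i' < r ∧ ∃ l t', 1 ≤ l ∧ l + 1 < c ∧
        pl i' l ≤ t' ∧ t' < pl i' (l + 1) ∧ ψ ((P i').vert t') = ψ ((P i).vert t))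
    (hQ : ∀ j < c, ∀ s, ql j 0 ≤ s → s ≤ qu j (r - 1) → ψ ((Q j).vert s) ∈ B ∧
      ∃ S : Finset ℕ, 4 * A.card + 2 * B.card ≤ S.card ∧ ∀ j' ∈ S, j' < c ∧ ∃ s',
        ql j' 0 ≤ s' ∧ s' ≤ qu j' (r - 1) ∧ ψ ((Q j').vert s') = ψ ((Q j).vert s)) :
    ¬ IsLinearColoring G ψ := by
  classical
  set colP : α → Prop := fun a => ∃ i < r, ∃ t, pl i 0 ≤ t ∧ t ≤ pu i (c - 1) ∧
    ψ ((P i).vert t) = a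
  set colQ : α → Prop := fun a => ∃ j < c, ∃ s, ql j 0 ≤ s ∧ s ≤ qu j (r - 1) ∧
    ψ ((Q j).vert s) = a
  set A' := A.filter colP
  -- A color found on both rows and columns is repeated as a row color, so only the remaining column
  -- colors need attention. The factor `Bool` below provides two occurrences of each color.
  set B' := B.filter fun a => colQ a ∧ ¬ colP a
  have hA' : A'.card ≤ A.card := Finset.card_filter_le _ _
  have hB' : B'.card ≤ B.card := Finset.card_filter_le _ _
  have hrow : ∀ z : A' × Bool, ∃ S : Finset ℕ, 10 * A.card + 4 ≤ S.card ∧ ∀ i' ∈ S, i' < r ∧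
      ∃ l t', 1 ≤ l ∧ l + 1 < c ∧ pl i' l ≤ t' ∧ t' < pl i' (l + 1) ∧
        ψ ((P i').vert t') = z.1 := by
    rintro ⟨⟨a, ha⟩, b⟩
    obtain ⟨i, hi, t, h1, h2, rfl⟩ := (Finset.mem_filter.1 ha).2
    exact (hP i hi t h1 h2).2
  choose SP hSP hSP' using hrow
  -- Four border rows are excluded, and distance more than two blocks five rows for each of at most
  -- `2 * A.card` choices: this is the threshold `10 * A.card + 4`.
  obtain ⟨i, hi⟩ := exists_spread SP {0, 1, r - 2, r - 1} 2 (fun z => by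
    have h1 : ({0, 1, r - 2, r - 1} : Finset ℕ).card ≤ 4 := Finset.card_le_four
    have h2 := hSP z
    rw [Fintype.card_prod, Fintype.card_coe, Fintype.card_bool]
    omega)
  have hi' := fun z => hSP' z (i z) (hi z).1
  choose hir l t hl1 hlc htl htu hψt using hi'
  have hcol : ∀ w : B' × Bool, ∃ S : Finset ℕ, 4 * A.card + 2 * B.card ≤ S.card ∧
      ∀ j' ∈ S, j' < c ∧ ∃ g s', g + 1 < r ∧ qu j' g ≤ s' ∧ s' ≤ ql j' (g + 1) ∧
        ψ ((Q j').vert s') = w.1 := by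
    rintro ⟨⟨a, ha⟩, b⟩
    obtain ⟨-, ⟨j, hj, s, h1, h2, rfl⟩, hnP⟩ := Finset.mem_filter.1 ha
    obtain ⟨-, S, hS, hS'⟩ := hQ j hj s h1 h2
    refine ⟨S, hS, fun j' hj' => ?_⟩
    obtain ⟨hj'c, s', h3, h4, h5⟩ := hS' j' hj'
    -- The color does not occur on the rows, so the position avoids all cells. It hence lies on a
    -- segment between consecutive rows, which a single column edge covers.
    have hcellP : ∀ g < r, ql j' g ≤ s' → qu j' g < s' := by
      intro g hg h6
      by_contra h7
      have hmem : (Q j').vert s' ∈ cellSet P pl pu g j' := by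
        rw [H.cellSet_swap (Finset.mem_range.2 hg) (Finset.mem_range.2 hj'c)]
        exact ⟨s', h6, not_lt.1 h7, rfl⟩
      obtain ⟨t, h8, h9, h10⟩ := hmem
      refine hnP ⟨g, hg, t, ?_, ?_, by rw [h10]; exact h5⟩
      · exact (H.pl_mono (Finset.mem_range.2 hg) (Finset.mem_range.2 hc)
          (Finset.mem_range.2 hj'c) (Nat.zero_le _)).trans h8
      · exact h9.trans (H.pu_mono (Finset.mem_range.2 hg) (Finset.mem_range.2 hj'c)
          (Finset.mem_range.2 (by omega)) (by omega))
    have h6 : s' < ql j' (r - 1) := by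
      by_contra h6
      have := hcellP (r - 1) (by omega) (not_lt.1 h6)
      omega
    obtain ⟨g, -, h7, h8, h9⟩ := exists_interval (ql j') (Nat.zero_le (r - 1)) h3 h6
    exact ⟨hj'c, g, s', by omega, (hcellP g (by omega) h8).le, h9.le, h5⟩
  choose SQ hSQ hSQ' using hcol
  -- At most `4 * A.card` columns `l z` and `l z + 1` are excluded, and distinctness accounts for
  -- the remaining `2 * B.card` of the threshold.
  obtain ⟨j, hj⟩ := exists_spread SQ (Finset.univ.image l ∪ Finset.univ.image fun z => l z + 1) 0
    (fun w => by
      have h1 : (Finset.univ.image l ∪ Finset.univ.image fun z => l z + 1).card ≤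
          A'.card * 2 + A'.card * 2 := by
        refine (Finset.card_union_le _ _).trans (Nat.add_le_add ?_ ?_) <;>
        · refine Finset.card_image_le.trans ?_
          rw [Finset.card_univ, Fintype.card_prod, Fintype.card_coe, Fintype.card_bool]
      have h2 := hSQ w
      rw [Fintype.card_prod, Fintype.card_coe, Fintype.card_bool]
      omega)
  have hj' := fun w => hSQ' w (j w) (hj w).1
  choose hjc g s hgr hsl hsu hψs using hj'
  obtain ⟨a, b, U, E, hE, hU, hp, hrowE, hcolE⟩ := exists_grid_path (c := c) hr i l g j
    (fun z => by
      have h1 := (hi z).2.1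
      have h2 := hir z
      simp only [Finset.mem_insert, Finset.mem_singleton, not_or] at h1
      omega)
    (fun z z' h => (hi z).2.2 z' h) (fun z => ⟨hl1 z, hlc z⟩) hgr hjc
    (fun w w' h => by
      by_contra hne
      have := (hj w).2.2 w' hne
      omega)
    (fun w z => by
      have h1 := (hj w).2.1
      simp only [Finset.mem_union, Finset.mem_image, Finset.mem_univ, true_and, not_or,
        not_exists] at h1
      exact ⟨fun h => h1.1 z h.symm, fun h => h1.2 z h.symm⟩) hc
  obtain ⟨p, hpU, hprow, hpcol, hpcell⟩ := H.exists_path hE hU hp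
  have hmemP : ∀ z, (P (i z)).vert (t z) ∈ p.verts := by
    intro z
    obtain ⟨l', hl'⟩ : ∃ l', l z = l' + 1 := ⟨l z - 1, by have := hl1 z; omega⟩
    have h1 := htl z
    have h2 := htu z
    have h3 := (hrowE z).1
    have h4 := (hrowE z).2
    rw [hl', Nat.add_sub_cancel] at h4
    rw [hl'] at h1 h2 h3
    -- Either the position is on the segment after the cell, covered by the second row edge, or it
    -- is in the cell, which is covered because the path passes straight through it.
    rcases Nat.lt_or_ge (pu (i z) (l' + 1)) (t z) with h | h
    · exact hprow _ _ h3 ⟨_, h.le, h2.le, rfl⟩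
    · exact hpcell _ _ h4 h3 ⟨_, h1, h, rfl⟩
  have hmemQ : ∀ w, (Q (j w)).vert (s w) ∈ p.verts := fun w =>
    hpcol _ _ (hcolE w) ⟨_, hsl w, hsu w, rfl⟩
  have hlenP : ∀ z, t z ≤ (P (i z)).length := fun z => by
    have h1 := Finset.mem_range.2 (hir z)
    have h2 := Finset.mem_range.2 (hlc z)
    exact (htu z).le.trans ((H.pl_le h1 h2).trans (H.pu_le _ h1 _ h2))
  have hlenQ : ∀ w, s w ≤ (Q (j w)).length := fun w => by
    have h1 := Finset.mem_range.2 (hjc w)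
    have h2 := Finset.mem_range.2 (hgr w)
    exact (hsu w).trans ((H.swap.pl_le h1 h2).trans (H.qu_le _ h1 _ h2))
  intro hψ
  obtain ⟨v, hv, hcenter⟩ := hψ p
  have hnotP : ¬ colP (ψ v) := by
    rintro hvP
    have hvA : ψ v ∈ A' := by
      obtain ⟨i, hi, t, h1, h2, h3⟩ := id hvP
      exact Finset.mem_filter.2 ⟨h3 ▸ (hP i hi t h1 h2).1, hvP⟩
    have h1 := hcenter _ (hmemP (⟨ψ v, hvA⟩, false)) (hψt _)
    have h2 := hcenter _ (hmemP (⟨ψ v, hvA⟩, true)) (hψt _)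
    have h3 := (H.eq_of_vert_eq (Finset.mem_range.2 (hir _)) (Finset.mem_range.2 (hir _))
      (hlenP _) (hlenP _) (h1.trans h2.symm)).1
    have h4 := (hi (⟨ψ v, hvA⟩, false)).2.2 (⟨ψ v, hvA⟩, true) (by simp)
    omega
  rcases hpU v hv with ⟨i, hi, t, h1, h2, h3⟩ | ⟨j', hj', s', h1, h2, h3⟩
  · exact hnotP ⟨i, hi, t, h1, h2, by rw [h3]⟩
  · have hvB : ψ v ∈ B' := Finset.mem_filter.2
      ⟨h3 ▸ (hQ j' hj' s' h1 h2).1, ⟨j', hj', s', h1, h2, by rw [h3]⟩, hnotP⟩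
    have h1 := hcenter _ (hmemQ (⟨ψ v, hvB⟩, false)) (hψs _)
    have h2 := hcenter _ (hmemQ (⟨ψ v, hvB⟩, true)) (hψs _)
    have h3 := (H.swap.eq_of_vert_eq (Finset.mem_range.2 (hjc _)) (Finset.mem_range.2 (hjc _))
      (hlenQ _) (hlenQ _) (h1.trans h2.symm)).1
    have h4 := (hj (⟨ψ v, hvB⟩, false)).2.2 (⟨ψ v, hvB⟩, true) (by simp)
    omega

/-- In a grid with a linear coloring the number of rows or the number of columns is bounded in
terms of the numbers of colors. -/
theorem IsGrid.card_le {V I J α : Type*} [LinearOrder I] [LinearOrder J] {G : SimpleGraph V}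
    {P : I → GPath G} {Q : J → GPath G} {R : Finset I} {C : Finset J}
    {pl pu : I → J → ℕ} {ql qu : J → I → ℕ} (H : IsGrid P Q R C pl pu ql qu) {ψ : V → α}
    (hψ : IsLinearColoring G ψ) (A B : Finset α) (hA : ∀ i ∈ R, ∀ t, ψ ((P i).vert t) ∈ A)
    (hB : ∀ j ∈ C, ∀ s, ψ ((Q j).vert s) ∈ B) :
    R.card ≤ A.card * (10 * A.card + 4) + 1 ∨
      C.card ≤ B.card * (4 * A.card + 2 * B.card) + 2 * A.card := by
  by_contra hcon
  push Not at hcon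
  obtain ⟨R', hR', C', hC', h1, h2, hP, hQ⟩ := exists_robust (10 * A.card + 4)
    (4 * A.card + 2 * B.card)
    (fun i C => {a | ∃ j₁ ∈ C, ∃ j₂ ∈ C, ∃ t, pl i j₁ ≤ t ∧ t ≤ pu i j₂ ∧ ψ ((P i).vert t) = a})
    (fun j R => {a | ∃ i₁ ∈ R, ∃ i₂ ∈ R, ∃ s, ql j i₁ ≤ s ∧ s ≤ qu j i₂ ∧ ψ ((Q j).vert s) = a})
    (fun i C C' hC a ⟨j₁, h₁, j₂, h₂, h⟩ => ⟨j₁, hC h₁, j₂, hC h₂, h⟩)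
    (fun j R R' hR a ⟨j₁, h₁, j₂, h₂, h⟩ => ⟨j₁, hR h₁, j₂, hR h₂, h⟩) A B R C
    (fun i hi a ⟨_, _, _, _, t, _, _, h⟩ => h ▸ hA i hi t)
    (fun j hj a ⟨_, _, _, _, s, _, _, h⟩ => h ▸ hB j hj s)
  have hr : 2 ≤ R'.card := by omega
  have hc : 0 < C'.card := by omega
  obtain ⟨ρ, hρ, hρlt, hρsurj⟩ := exists_enumeration (Finset.card_pos.1 (by omega : 0 < R'.card))
  obtain ⟨γ, hγ, hγlt, hγsurj⟩ := exists_enumeration (Finset.card_pos.1 hc)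
  have H₁ := H.mono hR' hC'
  have H' := H₁.comp (R' := Finset.range R'.card) (C' := Finset.range C'.card)
    (fun i hi => hρ i (Finset.mem_range.1 hi)) (fun j hj => hγ j (Finset.mem_range.1 hj))
    (fun i _ i' hi' h => hρlt i i' h (Finset.mem_range.1 hi'))
    (fun j _ j' hj' h => hγlt j j' h (Finset.mem_range.1 hj'))
  have hγlt' : ∀ m n, m < C'.card → γ m < γ n → m < n := by
    intro m n hm h
    by_contra h'
    rcases (not_lt.1 h').eq_or_lt with rfl | h''
    · exact lt_irrefl _ h
    · exact lt_asymm h (hγlt n m h'' hm)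
  refine H'.not_isLinearColoring_of_range hr hc ψ A B (fun i hi t ht ht' => ?_)
    (fun j hj s hs hs' => ?_) hψ
  · refine ⟨hA _ (hR' (hρ i hi)) t, ?_⟩
    obtain ⟨S, hSR, hS, hS'⟩ := hP _ (hρ i hi) (ψ ((P (ρ i)).vert t))
      ⟨γ 0, hγ 0 hc, γ (C'.card - 1), hγ _ (by omega), t, ht, ht', rfl⟩
    classical
    refine ⟨(Finset.range R'.card).filter fun n => ρ n ∈ S, hS.trans ?_, fun i' hi' => ?_⟩
    · refine (Finset.card_le_card (fun x hx => ?_)).trans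
        (Finset.card_image_le (f := ρ))
      obtain ⟨n, hn, rfl⟩ := hρsurj x (hSR hx)
      exact Finset.mem_image.2 ⟨n, Finset.mem_filter.2 ⟨Finset.mem_range.2 hn, hx⟩, rfl⟩
    · obtain ⟨hi', hi'S⟩ := Finset.mem_filter.1 hi'
      refine ⟨Finset.mem_range.1 hi', ?_⟩
      obtain ⟨j₁, hj₁, j₂, hj₂, t', h3, h4, h5⟩ := hS' _ hi'S
      -- Inner columns have a column on either side, so the occurrence lies after the crossing with
      -- column `1` has begun and before the one with the last column. This yields `1 ≤ l` and `l +
      -- 1 < c`, the room for a row edge on each side.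
      obtain ⟨hj₁, ⟨a, ha, haj⟩, -⟩ := Finset.mem_filter.1 hj₁
      obtain ⟨hj₂, -, ⟨b, hb, hbj⟩⟩ := Finset.mem_filter.1 hj₂
      obtain ⟨n₁, hn₁, rfl⟩ := hγsurj _ hj₁
      obtain ⟨n₂, hn₂, rfl⟩ := hγsurj _ hj₂
      obtain ⟨m₁, hm₁, rfl⟩ := hγsurj _ ha
      obtain ⟨m₂, hm₂, rfl⟩ := hγsurj _ hb
      have h6 := hγlt' _ _ hm₁ haj
      have h7 := hγlt' _ _ hn₂ hbj
      have h8 := H'.pl_mono hi' (Finset.mem_range.2 (by omega)) (Finset.mem_range.2 hn₁)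
        (by omega : 1 ≤ n₁)
      have h9 := H'.pl_mono hi' (Finset.mem_range.2 hm₂)
        (Finset.mem_range.2 (by omega : C'.card - 1 < C'.card)) (by omega : m₂ ≤ C'.card - 1)
      have h10 := H'.pu_lt i' hi' n₂ (Finset.mem_range.2 hn₂) m₂ (Finset.mem_range.2 hm₂) h7
      obtain ⟨l, h11, h12, h13, h14⟩ := exists_interval (fun l => pl (ρ i') (γ l))
        (by omega : 1 ≤ C'.card - 1) (h8.trans h3) (h4.trans_lt (h10.trans_le h9))
      exact ⟨l, t', h11, by omega, h13, h14, h5⟩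
  · refine ⟨hB _ (hC' (hγ j hj)) s, ?_⟩
    obtain ⟨S, hSC, hS, hS'⟩ := hQ _ (hγ j hj) (ψ ((Q (γ j)).vert s))
      ⟨ρ 0, hρ 0 (by omega), ρ (R'.card - 1), hρ _ (by omega), s, hs, hs', rfl⟩
    classical
    refine ⟨(Finset.range C'.card).filter fun n => γ n ∈ S, hS.trans ?_, fun j' hj' => ?_⟩
    · refine (Finset.card_le_card (fun x hx => ?_)).trans
        (Finset.card_image_le (f := γ))
      obtain ⟨n, hn, rfl⟩ := hγsurj x (hSC hx)
      exact Finset.mem_image.2 ⟨n, Finset.mem_filter.2 ⟨Finset.mem_range.2 hn, hx⟩, rfl⟩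
    · obtain ⟨hj', hj'S⟩ := Finset.mem_filter.1 hj'
      refine ⟨Finset.mem_range.1 hj', ?_⟩
      obtain ⟨i₁, hi₁, i₂, hi₂, s', h3, h4, h5⟩ := hS' _ hj'S
      obtain ⟨n₁, hn₁, rfl⟩ := hρsurj _ hi₁
      obtain ⟨n₂, hn₂, rfl⟩ := hρsurj _ hi₂
      have h8 := H'.swap.pl_mono hj' (Finset.mem_range.2 (by omega)) (Finset.mem_range.2 hn₁)
        (Nat.zero_le n₁)
      have h9 := H'.swap.pu_mono hj' (Finset.mem_range.2 hn₂)
        (Finset.mem_range.2 (by omega : R'.card - 1 < R'.card)) (by omega : n₂ ≤ R'.card - 1)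
      exact ⟨s', h8.trans h3, h4.trans h9, h5⟩

/-! ### From pseudogrids to grids -/

/-- A subpath of `q` all of whose vertices and edges lie on `p` is a subpath of `p`, possibly
in the reverse direction. -/
theorem GPath.exists_contiguous {V : Type*} {G : SimpleGraph V} (p q : GPath G) (a d : ℕ)
    (hd : a + d ≤ q.length) (hv : q.vert a ∈ p.verts)
    (he : ∀ s, a ≤ s → s < a + d → s(q.vert s, q.vert (s + 1)) ∈ p.edges) :
    ∃ m, m + d ≤ p.length ∧ ((∀ x ≤ d, p.vert (m + x) = q.vert (a + x)) ∨
      ∀ x ≤ d, p.vert (m + x) = q.vert (a + (d - x))) := by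
  induction d with
  | zero =>
    obtain ⟨m, hm, e⟩ := p.exists_vert hv
    exact ⟨m, hm, .inl fun x hx => by rw [Nat.le_zero.1 hx]; exact e⟩
  | succ d ih =>
    obtain ⟨m, hm, h⟩ := ih (by omega) (fun s h h' => he s h (by omega))
    obtain ⟨n, hn, e⟩ := (Walk.mk_mem_edges_iff_exists _).1
      (he (a + d) (by omega) (by omega))
    change n < p.length at hn
    change s(p.vert n, p.vert (n + 1)) = _ at e
    have hne : ∀ {x}, x < a + d + 1 → q.vert (a + d + 1) ≠ q.vert x := fun hx h => by
      have := q.vert_inj (by omega) (by omega) h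
      omega
    rw [Sym2.eq_iff] at e
    -- If the new edge ran on `p` against the direction found so far, `q` would return to a vertex
    -- it has left. So the directions can disagree only as long as the part found is a single
    -- vertex, which has no direction.
    rcases h with h | h <;> rcases e with ⟨e₁, e₂⟩ | ⟨e₁, e₂⟩
    · have h1 := p.vert_inj (by omega) (by omega) ((h d le_rfl).trans e₁.symm)
      refine ⟨m, by omega, .inl fun x hx => ?_⟩
      rcases Nat.lt_or_ge d x with h2 | h2
      · obtain rfl : x = d + 1 := by omega
        rw [← add_assoc, h1, e₂, add_assoc]
      · exact h x h2
    · have h1 := p.vert_inj (by omega) (by omega) ((h d le_rfl).trans e₂.symm)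
      rcases Nat.eq_zero_or_pos d with rfl | hd0
      · refine ⟨n, by omega, .inr fun x hx => ?_⟩
        rcases Nat.lt_or_ge 0 x with h2 | h2
        · obtain rfl : x = 1 := by omega
          exact e₂
        · obtain rfl : x = 0 := by omega
          exact e₁
      · have h2 := h (d - 1) (by omega)
        rw [show m + (d - 1) = n by omega, e₁] at h2
        exact absurd h2 (hne (by omega))
    · have h0 := h 0 (Nat.zero_le _)
      have h1 := p.vert_inj (by omega) (by omega) (h0.trans e₁.symm)
      rcases Nat.eq_zero_or_pos d with rfl | hd0
      · refine ⟨m, by omega, .inl fun x hx => ?_⟩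
        rcases Nat.lt_or_ge 0 x with h2 | h2
        · obtain rfl : x = 1 := by omega
          rw [show m = n from h1, e₂]
        · obtain rfl : x = 0 := by omega
          exact h0
      · have h2 := h 1 (by omega)
        rw [show m + 1 = n + 1 by omega, e₂] at h2
        exact absurd h2 (hne (by omega))
    · have h0 := h 0 (Nat.zero_le _)
      have h1 := p.vert_inj (by omega) (by omega) (h0.trans e₂.symm)
      refine ⟨n, by omega, .inr fun x hx => ?_⟩
      rcases Nat.eq_zero_or_pos x with rfl | hx0
      · exact e₁
      · rw [show n + x = m + (x - 1) by omega, h (x - 1) (by omega)]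
        congr 1
        omega

section

variable {V : Type*} {G : SimpleGraph V} {k : ℕ} {p : GPath G} {Q : Fin k → GPath G}
  {cut : ℕ → ℕ}

theorem cut_mono (hmono : ∀ t ≤ 2 * k, cut t ≤ cut (t + 1)) {s t : ℕ} (hst : s ≤ t)
    (ht : t ≤ 2 * k + 1) : cut s ≤ cut t := by
  induction t, hst using Nat.le_induction with
  | base => exact le_rfl
  | succ t _ ih => exact (ih (by omega)).trans (hmono t (by omega))

/-- Between `cut 1` and `cut (2 * k)` each position is in a block `T` or inside a piece `S`, because
the ends of those pieces belong to neighboring blocks. The inside of a piece avoids the family, and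
disjointness of the family determines the block. -/
theorem locate (hdisj : Pairwise fun i j => Disjoint (Q i).verts (Q j).verts)
    (hmono : ∀ t ≤ 2 * k, cut t ≤ cut (t + 1))
    (hT : ∀ j : Fin k, ∀ t, cut (2 * j + 1) ≤ t → t ≤ cut (2 * j + 2) → p.vert t ∈ (Q j).verts)
    (hS : ∀ j ≤ k, ∀ l : Fin k, ∀ t, cut (2 * j) < t → t < cut (2 * j + 1) →
      p.vert t ∉ (Q l).verts)
    {j : Fin k} {t : ℕ} (h1 : cut 1 ≤ t) (h2 : t ≤ cut (2 * k)) (h : p.vert t ∈ (Q j).verts) :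
    cut (2 * j + 1) ≤ t ∧ t ≤ cut (2 * j + 2) := by
  have hk := j.2
  obtain ⟨j', h3, h4⟩ : ∃ j' : Fin k, cut (2 * j' + 1) ≤ t ∧ t ≤ cut (2 * j' + 2) := by
    rcases h2.eq_or_lt with h2 | h2
    · refine ⟨⟨k - 1, by omega⟩, ?_, ?_⟩
      · rw [h2]
        exact cut_mono hmono (by simp only; omega) (by omega)
      · rw [h2]
        exact cut_mono hmono (by simp only; omega) (by simp only; omega)
    · obtain ⟨l, h3, h4, h5, h6⟩ := exists_interval cut (by omega : 1 ≤ 2 * k) h1 h2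
      rcases Nat.even_or_odd' l with ⟨m, rfl | rfl⟩
      · rcases h5.eq_or_lt with h5 | h5
        · refine ⟨⟨m - 1, by omega⟩, ?_, ?_⟩
          · rw [← h5]
            exact cut_mono hmono (by simp only; omega) (by omega)
          · rw [← h5]
            exact cut_mono hmono (by simp only; omega) (by simp only; omega)
        · exact absurd h (hS m (by omega) j t h5 h6)
      · exact ⟨⟨m, by omega⟩, h5, h6.le⟩
  have h5 := hT j' t h3 h4
  obtain rfl : j' = j := by
    by_contra hne
    exact Set.disjoint_left.1 (hdisj hne) h5 h
  exact ⟨h3, h4⟩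

/-- Outside the range of `locate` there are only the first and the last piece, whose vertices other
than the ends of `p` again avoid the family. -/
theorem locate_of_ne_ends (hdisj : Pairwise fun i j => Disjoint (Q i).verts (Q j).verts)
    (h0 : cut 0 = 0) (hlen : cut (2 * k + 1) = p.length)
    (hmono : ∀ t ≤ 2 * k, cut t ≤ cut (t + 1))
    (hT : ∀ j : Fin k, ∀ t, cut (2 * j + 1) ≤ t → t ≤ cut (2 * j + 2) → p.vert t ∈ (Q j).verts)
    (hS : ∀ j ≤ k, ∀ l : Fin k, ∀ t, cut (2 * j) < t → t < cut (2 * j + 1) →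
      p.vert t ∉ (Q l).verts)
    {j : Fin k} {t : ℕ} (ht : t ≤ p.length) (h : p.vert t ∈ (Q j).verts)
    (hsrc : p.vert 0 ∉ (Q j).verts) (htgt : p.vert p.length ∉ (Q j).verts) :
    cut (2 * j + 1) ≤ t ∧ t ≤ cut (2 * j + 2) := by
  have ht0 : t ≠ 0 := fun e => hsrc (e ▸ h)
  have ht1 : t ≠ p.length := fun e => htgt (e ▸ h)
  refine locate hdisj hmono hT hS ?_ ?_ h
  · by_contra h1
    exact hS 0 (Nat.zero_le _) j t (by simp only [Nat.mul_zero]; omega) (not_le.1 h1) h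
  · by_contra h1
    exact hS k le_rfl j t (not_le.1 h1) (by omega) h

end

/-- The rows of `R` and the columns of `C` of a pseudogrid form a grid if no row of `R` has an
end on a column of `C`. -/
theorem IsPseudogrid.exists_isGrid {V : Type*} {G : SimpleGraph V} {k : ℕ}
    {P Q : Fin k → GPath G} (H : IsPseudogrid P Q) {R C : Finset (Fin k)}
    (hRC : ∀ i ∈ R, ∀ j ∈ C, (P i).vert 0 ∉ (Q j).verts ∧
      (P i).vert (P i).length ∉ (Q j).verts) :
    ∃ pl pu ql qu, IsGrid P Q R C pl pu ql qu := by
  choose cP hP0 hPlen hPmono hPT hPS using H.crosses_left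
  choose cQ hQ0 hQlen hQmono hQT hQS using H.crosses_right
  have hqle : ∀ j i : Fin k, cQ j (2 * i + 1) ≤ cQ j (2 * i + 2) := fun j i =>
    hQmono j _ (by omega)
  have hqlen : ∀ j i : Fin k, cQ j (2 * i + 2) ≤ (Q j).length := fun j i => by
    rw [← hQlen j]
    exact cut_mono (hQmono j) (by omega) le_rfl
  -- The cells are taken from the cuts of the columns; their positions on the rows, starting at `m i
  -- j`, come from contiguity rather than from the cuts of the rows.
  have hcont : ∀ i j : Fin k, ∃ m, m + (cQ j (2 * i + 2) - cQ j (2 * i + 1)) ≤ (P i).length ∧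
      ((∀ x ≤ cQ j (2 * i + 2) - cQ j (2 * i + 1),
        (P i).vert (m + x) = (Q j).vert (cQ j (2 * i + 1) + x)) ∨
      ∀ x ≤ cQ j (2 * i + 2) - cQ j (2 * i + 1), (P i).vert (m + x) =
        (Q j).vert (cQ j (2 * i + 1) + (cQ j (2 * i + 2) - cQ j (2 * i + 1) - x))) := by
    intro i j
    have h1 := hqle j i
    have h2 := hqlen j i
    exact (P i).exists_contiguous (Q j) _ _ (by omega) ((hQT j i).1 _ le_rfl h1)
      fun s hs hs' => (hQT j i).2 s hs (by omega)
  choose m hm hm' using hcont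
  have hmem : ∀ i j : Fin k, ∀ x ≤ cQ j (2 * i + 2) - cQ j (2 * i + 1),
      (P i).vert (m i j + x) ∈ (Q j).verts := by
    intro i j x hx
    rcases hm' i j with h | h
    · rw [h x hx]
      exact (Q j).vert_mem
    · rw [h x hx]
      exact (Q j).vert_mem
  -- As row `i` has no end on column `j`, the cell lies inside the block that the cuts of row `i`
  -- assign to column `j`. This orders the cells along the row.
  have hloc : ∀ i ∈ R, ∀ j ∈ C, ∀ x ≤ cQ j (2 * i + 2) - cQ j (2 * i + 1),
      cP i (2 * j + 1) ≤ m i j + x ∧ m i j + x ≤ cP i (2 * j + 2) := by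
    intro i hi j hj x hx
    have := hm i j
    exact locate_of_ne_ends H.disjoint_right (hP0 i) (hPlen i) (hPmono i)
      (fun j => (hPT i j).1) (fun j hj l => (hPS i j hj l).1) (by omega) (hmem i j x hx)
      (hRC i hi j hj).1 (hRC i hi j hj).2
  refine ⟨m, fun i j => m i j + (cQ j (2 * i + 2) - cQ j (2 * i + 1)),
    fun j i => cQ j (2 * i + 1), fun j i => cQ j (2 * i + 2), ?_⟩
  constructor
  · exact fun i _ i' _ h => H.disjoint_left h
  · exact fun j _ j' _ h => H.disjoint_right h
  · exact fun i _ j _ => hm i j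
  · exact fun j _ i _ => hqlen j i
  · intro i hi j hj j' hj' hjj'
    have h1 := (hloc i hi j hj _ le_rfl).2
    have h2 := (hloc i hi j' hj' 0 (Nat.zero_le _)).1
    have h3 : cP i (2 * j + 2) ≤ cP i (2 * j' + 1) := cut_mono (hPmono i) (by omega) (by omega)
    refine lt_of_le_of_ne (by omega) fun e => ?_
    have h4 := hmem i j _ le_rfl
    have h5 := hmem i j' 0 (Nat.zero_le _)
    rw [e] at h4
    exact Set.disjoint_left.1 (H.disjoint_right hjj'.ne) h4 h5
  · intro j hj i hi i' hi' hii'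
    have h3 : cQ j (2 * i + 2) ≤ cQ j (2 * i' + 1) := cut_mono (hQmono j) (by omega) (by omega)
    refine lt_of_le_of_ne h3 fun e => ?_
    have h4 := (hQT j i).1 _ (hqle j i) le_rfl
    have h5 := (hQT j i').1 _ le_rfl (hqle j i')
    rw [e] at h4
    exact Set.disjoint_left.1 (H.disjoint_left hii'.ne) h4 h5
  · intro i _ j _
    have := hqle j i
    exact ⟨_, rfl, by omega, hm' i j⟩
  · intro i _ j _ i₁ _ i₂ _ j₁ _ j₂ _ t s _ _ h3 h4 e
    -- The position is between two crossings of the column, so nothing has to be assumed about the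
    -- ends of columns.
    refine locate H.disjoint_left (hQmono j) (fun i => (hQT j i).1)
      (fun i hi l => (hQS j i hi l).1) ?_ ?_ (e ▸ (P i).vert_mem)
    · exact (cut_mono (hQmono j) (by omega) (by omega)).trans h3
    · exact h4.trans (cut_mono (hQmono j) (by omega) (by omega))

/-- At most two columns contain an end of a given row. -/
theorem IsPseudogrid.exists_columns {V : Type*} {G : SimpleGraph V} {k : ℕ}
    {P Q : Fin k → GPath G} (H : IsPseudogrid P Q) (R : Finset (Fin k)) :
    ∃ C : Finset (Fin k), k ≤ C.card + 2 * R.card ∧ ∀ i ∈ R, ∀ j ∈ C,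
      (P i).vert 0 ∉ (Q j).verts ∧ (P i).vert (P i).length ∉ (Q j).verts := by
  classical
  have hcol : ∀ v : V, (Finset.univ.filter fun j => v ∈ (Q j).verts).card ≤ 1 := by
    intro v
    rw [Finset.card_le_one]
    intro j hj j' hj'
    by_contra hne
    exact Set.disjoint_left.1 (H.disjoint_right hne) (Finset.mem_filter.1 hj).2
      (Finset.mem_filter.1 hj').2
  set D := R.biUnion fun i => (Finset.univ.filter fun j => (P i).vert 0 ∈ (Q j).verts) ∪
    Finset.univ.filter fun j => (P i).vert (P i).length ∈ (Q j).verts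
  have hD : D.card ≤ R.card * 2 := Finset.card_biUnion_le_card_mul _ _ _ fun i _ =>
    (Finset.card_union_le _ _).trans (Nat.add_le_add (hcol _) (hcol _))
  refine ⟨Dᶜ, ?_, fun i hi j hj => ?_⟩
  · rw [Finset.card_compl, Fintype.card_fin]
    omega
  · simp only [D, Finset.mem_compl, Finset.mem_biUnion, Finset.mem_union, Finset.mem_filter,
      Finset.mem_univ, true_and, not_exists, not_and, not_or] at hj
    exact hj i hi

/-! ### The quadratic bound -/

theorem IsPseudogrid.le_numColors {V α : Type*} [Finite α] {G : SimpleGraph V} {k : ℕ}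
    {P Q : Fin k → GPath G} (H : IsPseudogrid P Q) {ψ : V → α} (hψ : IsLinearColoring G ψ) :
    k ≤ 100 * (numColors ψ P + numColors ψ Q) ^ 2 := by
  rcases Nat.eq_zero_or_pos k with rfl | hk
  · exact Nat.zero_le _
  have key : ∀ P : Fin k → GPath G, ∃ A : Finset α, A.card = numColors ψ P ∧ 0 < A.card ∧
      ∀ i t, ψ ((P i).vert t) ∈ A := by
    intro P
    have hmem : ∀ i t, ψ ((P i).vert t) ∈
        (Set.toFinite (ψ '' ⋃ i, (P i).verts)).toFinset := fun i t => by
      rw [Set.Finite.mem_toFinset]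
      exact Set.mem_image_of_mem _ (Set.mem_iUnion.2 ⟨i, (P i).vert_mem⟩)
    exact ⟨_, (Set.ncard_eq_toFinset_card _ _).symm, Finset.card_pos.2 ⟨_, hmem ⟨0, hk⟩ 0⟩, hmem⟩
  obtain ⟨A, hA, hA0, hAmem⟩ := key P
  obtain ⟨B, hB, hB0, hBmem⟩ := key Q
  -- A third of the rows spoils at most two thirds of the columns, so about `k / 3` of both remain.
  obtain ⟨R, -, hR⟩ := Finset.exists_subset_card_eq (s := (Finset.univ : Finset (Fin k)))
    (n := k / 3) (by rw [Finset.card_univ, Fintype.card_fin]; omega)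
  obtain ⟨C, hC, hRC⟩ := H.exists_columns R
  obtain ⟨pl, pu, ql, qu, hgrid⟩ := H.exists_isGrid hRC
  have := hgrid.card_le hψ A B (fun i _ t => hAmem i t) (fun j _ s => hBmem j s)
  rw [← hA, ← hB]
  generalize A.card = a at *
  generalize B.card = b at *
  -- Since `a` and `b` are positive, the linear and constant terms are absorbed by the quadratic
  -- ones, and `100` is a generous constant in both cases.
  rcases this with h | h
  · have h1 : k ≤ 3 * (a * (10 * a + 4)) + 5 := by omega
    nlinarith [Nat.zero_le (a * b), Nat.zero_le (b * b)]
  · have h1 : k ≤ 3 * (b * (4 * a + 2 * b) + 2 * a) := by omega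
    nlinarith [Nat.zero_le (a * b), Nat.zero_le (b * b), Nat.zero_le (a * a)]

theorem exists_isLinearColoring {V : Type*} [Finite V] (G : SimpleGraph V) :
    ∃ ψ : V → Fin (linearColoringNumber G), IsLinearColoring G ψ := by
  refine Nat.sInf_mem (s := {n : ℕ | ∃ ψ : V → Fin n, IsLinearColoring G ψ}) ?_
  obtain ⟨n, ⟨e⟩⟩ := Finite.exists_equiv_fin V
  exact ⟨n, e, fun p => ⟨p.src, p.walk.start_mem_support, fun x _ h => e.injective h⟩⟩

theorem numColors_le {V : Type*} {G : SimpleGraph V} {n k : ℕ} (ψ : V → Fin n)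
    (P : Fin k → GPath G) : numColors ψ P ≤ n := by
  unfold numColors
  exact (Set.ncard_le_card _).trans (by simp)

end LinearColoring

theorem mainTheorem6 :
    (∃ c : ℝ, 0 < c ∧ ∀ (V : Type*) [Finite V] (G : SimpleGraph V) (k : ℕ),
      LinearColoring.ContainsPseudogrid G k →
        c * Real.sqrt (k : ℝ) ≤ (LinearColoring.linearColoringNumber G : ℝ)) ∧
    (∀ (V : Type*) [Finite V] (G : SimpleGraph V) (n : ℕ) (ψ : V → Fin n),
      LinearColoring.IsLinearColoring G ψ →
        ∀ (k : ℕ) (P Q : Fin k → LinearColoring.GPath G), LinearColoring.IsPseudogrid P Q →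
          k ≤ 100 * (LinearColoring.numColors ψ P + LinearColoring.numColors ψ Q) ^ 2) := by
  refine ⟨⟨1 / 20, by norm_num, fun V _ G k ⟨P, Q, H⟩ => ?_⟩,
    fun V _ G n ψ hψ k P Q H => H.le_numColors hψ⟩
  obtain ⟨ψ, hψ⟩ := LinearColoring.exists_isLinearColoring G
  have h1 := H.le_numColors hψ
  have h2 := LinearColoring.numColors_le ψ P
  have h3 := LinearColoring.numColors_le ψ Q
  generalize LinearColoring.linearColoringNumber G = n at *
  have h4 : k ≤ (20 * n) ^ 2 := by
    calc k ≤ 100 * (LinearColoring.numColors ψ P + LinearColoring.numColors ψ Q) ^ 2 := h1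
      _ ≤ 100 * (n + n) ^ 2 := by gcongr
      _ = (20 * n) ^ 2 := by ring
  have h5 : Real.sqrt k ≤ 20 * n := by
    rw [Real.sqrt_le_left (by positivity)]
    exact_mod_cast h4
  linarith
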